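/- Let $k$ be a field of characteristic $p>0$ and let $n\ge r$ be integers. Let $\tau_r$ be the full transformation semigroup of $\{1,\dots,r\}$ under composition, and let $\Lambda=\Lambda(r,n)$ be the set of compositions of $r$ into $n$ nonnegative parts. For $\lambda\in\Lambda$ the $i$-th $\lambda$-block is $\{x:\lambda_1+\dots+\lambda_{i-1}<x\le\lambda_1+\dots+\lambda_i\}$, and $G_\lambda\subseteq\mathfrak S_r\subseteq\tau_r$ is the Young subgroup of the permutations mapping every $\lambda$-block to itself. For $\lambda,\mu\in\Lambda$ and $\alpha\in\tau_r$ let $D_\alpha=G_\lambda\alpha G_\mu$ and let $n_R(D_\alpha)$ be the order of $\{\sigma\in G_\lambda:\exists\pi\in G_\mu,\ \sigma\alpha=\alpha\pi\}$. Let $B_R$ be the right generalized Schur algebra over $k$ of $\tau_r$: it has the $k$-basis $f(\lambda,D,\mu)$, for $\lambda,\mu\in\Lambda$ and $D\in G_\lambda\backslash\tau_r/G_\mu$, and the product given by $f(\lambda,D_1,\nu)f(\omega,D_2,\mu)=0$ if $\nu\ne\omega$, and $$f(\lambda,D_\alpha,\nu)\,f(\nu,D_\beta,\mu)=\sum_{D}\frac{n_R(D)\cdot\#\{\rho\in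 G_\nu:\alpha\rho\beta\in D\}}{n_R(D_\alpha)\,n_R(D_\beta)}\,f(\lambda,D,\mu)$$ (the coefficients are integers). Write $f(\lambda,\alpha,\mu)=f(\lambda,D_\alpha,\mu)$ and $1_\lambda=f(\lambda,1,\lambda)$. Write $\mu<\lambda$ if the decreasing rearrangement of $\mu$ is lexicographically smaller than that of $\lambda$, and put $e_\lambda=\sum_{\mu<\lambda}1_\mu$, $B_R^\lambda=1_\lambda B_R1_\lambda$ and $C_R^\lambda=B_R^\lambda/(B_Re_\lambda B_R\cap B_R^\lambda)$, with projection $\Pi_R:B_R^\lambda\to C_R^\lambda$. Let $\lambda\in\Lambda$ be a $p$-partition, that is, $\lambda_1\ge\dots\ge\lambda_n$ and every nonzero part is a power of $p$. Let $s_i$ be the number of parts equal to $p^i$, let $m$ and $M$ be the smallest and the largest $i$ with $s_i\ne0$ (so $r\ge1$), and put $c_i=\sum_{j>i}s_jp^j$. Let $\phi_\lambda:\prod_{s_i>0}\tau_{s_i}\to\tau_r$ be the homomorphism with $$\phi_\lambda\big((\alpha_i)_i\big)\big(c_i+(a-1)p^i+b\big)=c_i+(\alpha_i(a)-1)p^i+b\qquad(1\le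 a\le s_i,\ 1\le b\le p^i),$$ let $S_r^\lambda$ be its image, and let $S'=\phi_\lambda\big(\tau_{s_m}\cdot\prod_{i=m+1}^M\mathfrak S_{s_i}\big)\subseteq S_r^\lambda$. Let $\psi_{\lambda,R}:k[S_r^\lambda]\to B_R^\lambda$ be the $k$-linear map with $\psi_{\lambda,R}(\alpha)=f(\lambda,\alpha,\lambda)$. Then the restriction $\Pi_R\circ\psi_{\lambda,R}:k[S']\to C_R^\lambda$ is an isomorphism of $k$-algebras, and there are isomorphisms of $k$-algebras $$C_R^\lambda\cong k[S']\cong k\Big[\tau_{s_m}\cdot\prod_{i=m+1}^M\mathfrak S_{s_i}\Big]\cong k[\tau_{s_m}]\otimes_k\Big(\bigotimes_{i=m+1}^M k[\mathfrak S_{s_i}]\Big).$$ -/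

import Mathlib

noncomputable section

namespace GSchur

open scoped Classical

/-! ### Double cosets in a monoid and the structure constants -/

section DoubleCosets

variable {M : Type*} [Monoid M]

/-- `a` and `b` lie in the same double coset `H a K`, for groups `H`, `K` of units of `M`. -/
def dcSetoid (H K : Subgroup Mˣ) : Setoid M where
  r a b := ∃ σ ∈ H, ∃ π ∈ K, b = (σ : M) * a * (π : M)
  iseqv :=
    { refl := fun a => ⟨1, H.one_mem, 1, K.one_mem, by simp⟩
      symm := by
        rintro a b ⟨σ, hσ, π, hπ, rfl⟩
        exact ⟨σ⁻¹, H.inv_mem hσ, π⁻¹, K.inv_mem hπ, by simp [mul_assoc]⟩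
      trans := by
        rintro a b c ⟨σ, hσ, π, hπ, rfl⟩ ⟨σ', hσ', π', hπ', rfl⟩
        exact ⟨σ' * σ, H.mul_mem hσ' hσ, π * π', K.mul_mem hπ hπ', by simp [mul_assoc]⟩ }

/-- The set of all double cosets `H α K`, `α ∈ M`. -/
def DC (H K : Subgroup Mˣ) : Type _ := Quotient (dcSetoid H K)

/-- The double coset `H α K`. -/
def DC.mk (H K : Subgroup Mˣ) (a : M) : DC H K := Quotient.mk (dcSetoid H K) a

theorem DC.mk_eq_iff {H K : Subgroup Mˣ} {a b : M} :
    DC.mk H K a = DC.mk H K b ↔ ∃ σ ∈ H, ∃ π ∈ K, b = (σ : M) * a * (π : M) :=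
  Quotient.eq (r := dcSetoid H K)

@[elab_as_elim]
theorem DC.ind {H K : Subgroup Mˣ} {P : DC H K → Prop} (h : ∀ a, P (DC.mk H K a)) (D : DC H K) :
    P D :=
  Quotient.ind h D

instance [Finite M] (H K : Subgroup Mˣ) : Fintype (DC H K) :=
  haveI : Finite (DC H K) := Quotient.finite (dcSetoid H K)
  Fintype.ofFinite _

/-- `G_R(H, α, K) = {σ ∈ H : ∃ π ∈ K, σ α = α π}`, the stabilizer in `H` of the right coset
`α K`. -/
def stabR (H : Subgroup Mˣ) (a : M) (K : Subgroup Mˣ) : Subgroup H where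
  carrier := {σ | ∃ π ∈ K, ((σ : Mˣ) : M) * a = a * (π : M)}
  one_mem' := ⟨1, K.one_mem, by simp⟩
  mul_mem' := by
    rintro σ τ ⟨π, hπ, h⟩ ⟨π', hπ', h'⟩
    refine ⟨π * π', K.mul_mem hπ hπ', ?_⟩
    calc (((σ * τ : H) : Mˣ) : M) * a = ((σ : Mˣ) : M) * (((τ : Mˣ) : M) * a) := by
          simp [mul_assoc]
      _ = a * ((π * π' : Mˣ) : M) := by rw [h', ← mul_assoc, h]; simp [mul_assoc]
  inv_mem' := by
    rintro σ ⟨π, hπ, h⟩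
    refine ⟨π⁻¹, K.inv_mem hπ, ?_⟩
    have : a = (((σ : Mˣ)⁻¹ : Mˣ) : M) * (a * (π : M)) := by rw [← h]; simp
    calc (((σ⁻¹ : H) : Mˣ) : M) * a = (((σ : Mˣ)⁻¹ : Mˣ) : M) * (a * (π : M)) * ((π⁻¹ : Mˣ) : M) := by
          simp [mul_assoc]
      _ = a * ((π⁻¹ : Mˣ) : M) := by rw [← this]

theorem mem_stabR {H : Subgroup Mˣ} {a : M} {K : Subgroup Mˣ} {σ : H} :
    σ ∈ stabR H a K ↔ ∃ π ∈ K, ((σ : Mˣ) : M) * a = a * (π : M) := Iff.rfl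

/-- `n_R(H, α, K)`, the order of `G_R(H, α, K)`. -/
def nRel (H : Subgroup Mˣ) (a : M) (K : Subgroup Mˣ) : ℕ := Nat.card (stabR H a K)

/-- `#{ρ ∈ K : α ρ β ∈ D}`. -/
def NRel {H K L : Subgroup Mˣ} (a b : M) (D : DC H L) : ℕ :=
  Nat.card {ρ : K // DC.mk H L (a * ((ρ : Mˣ) : M) * b) = D}

theorem nRel_congr {H K : Subgroup Mˣ} {a b : M}
    (h : ∃ σ ∈ H, ∃ π ∈ K, b = (σ : M) * a * (π : M)) : nRel H a K = nRel H b K := by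
  obtain ⟨σ, hσ, π, hπ, rfl⟩ := h
  refine Nat.card_congr ((MulAut.conj (⟨σ, hσ⟩ : H)).toEquiv.subtypeEquiv fun τ => ?_)
  change τ ∈ stabR H a K ↔ (⟨σ, hσ⟩ * τ * (⟨σ, hσ⟩ : H)⁻¹) ∈ stabR H _ K
  rw [mem_stabR, mem_stabR]
  constructor
  · rintro ⟨κ, hκ, e⟩
    refine ⟨π⁻¹ * κ * π, K.mul_mem (K.mul_mem (K.inv_mem hπ) hκ) hπ, ?_⟩
    simp only [Subgroup.coe_mul, Subgroup.coe_inv, Units.val_mul, mul_assoc, Units.inv_mul_cancel_left,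
      Units.mul_inv_cancel_left]
    rw [← mul_assoc _ a, e, mul_assoc]
  · rintro ⟨κ, hκ, e⟩
    refine ⟨π * κ * π⁻¹, K.mul_mem (K.mul_mem hπ hκ) (K.inv_mem hπ), ?_⟩
    simp only [Subgroup.coe_mul, Subgroup.coe_inv, Units.val_mul, mul_assoc, Units.inv_mul_cancel_left,
      Units.mul_right_inj] at e
    have := congrArg (fun x => x * ((π⁻¹ : Mˣ) : M)) e
    simpa [mul_assoc] using this

theorem NRel_congr {H K L : Subgroup Mˣ} {a b a' b' : M}
    (h : ∃ σ ∈ H, ∃ π ∈ K, a' = (σ : M) * a * (π : M))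
    (h' : ∃ σ ∈ K, ∃ π ∈ L, b' = (σ : M) * b * (π : M)) (D : DC H L) :
    NRel (K := K) a b D = NRel (K := K) a' b' D := by
  obtain ⟨σ, hσ, π, hπ, rfl⟩ := h
  obtain ⟨τ, hτ, κ, hκ, rfl⟩ := h'
  refine Nat.card_congr (((Equiv.mulLeft (⟨π, hπ⟩ : K)⁻¹).trans
    (Equiv.mulRight (⟨τ, hτ⟩ : K)⁻¹)).subtypeEquiv fun ρ => ?_)
  have : DC.mk H L (a * ((ρ : Mˣ) : M) * b) = DC.mk H L ((σ : M) * a * (π : M) *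
      ((((⟨π, hπ⟩ : K)⁻¹ * ρ * (⟨τ, hτ⟩ : K)⁻¹ : K) : Mˣ) : M) * ((τ : M) * b * (κ : M))) := by
    rw [DC.mk_eq_iff]
    exact ⟨σ, hσ, κ, hκ, by simp [mul_assoc]⟩
  rw [this]
  rfl

/-- `n_R(D)`, the common value of `n_R(H, α, K)` for `α ∈ D`. -/
def DC.nR {H K : Subgroup Mˣ} (D : DC H K) : ℕ :=
  Quotient.lift (fun a => nRel H a K) (fun _ _ h => nRel_congr h) D

/-- `N(D₁, D₂, D) = #{ρ ∈ K : α ρ β ∈ D}` for any `α ∈ D₁`, `β ∈ D₂`. -/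
def DC.N {H K L : Subgroup Mˣ} (D₁ : DC H K) (D₂ : DC K L) (D : DC H L) : ℕ :=
  Quotient.lift₂ (fun a b => NRel (K := K) a b D) (fun _ _ _ _ h h' => NRel_congr h h' D) D₁ D₂

@[simp] theorem DC.nR_mk {H K : Subgroup Mˣ} (a : M) : (DC.mk H K a).nR = nRel H a K := rfl

@[simp] theorem DC.N_mk {H K L : Subgroup Mˣ} (a b : M) (D : DC H L) :
    DC.N (DC.mk H K a) (DC.mk K L b) D = NRel (K := K) a b D := rfl

/-- The structure constant `n_R(D) N(D₁, D₂, D) / (n_R(D₁) n_R(D₂))`. The division is exact, see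
`structConst_mul`. -/
def structConst {H K L : Subgroup Mˣ} (D₁ : DC H K) (D₂ : DC K L) (D : DC H L) : ℕ :=
  D.nR * DC.N D₁ D₂ D / (D₁.nR * D₂.nR)

theorem N_eq_sum {H K L : Subgroup Mˣ} (a b : M) (D : DC H L) [Fintype K] :
    DC.N (DC.mk H K a) (DC.mk K L b) D
      = ∑ ρ : K, if DC.mk H L (a * ((ρ : Mˣ) : M) * b) = D then 1 else 0 := by
  rw [DC.N_mk, NRel, Finset.sum_boole, ← Fintype.card_subtype, Nat.card_eq_fintype_card,
    Nat.cast_id]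

theorem nRel_one (H : Subgroup Mˣ) : nRel H (1 : M) H = Nat.card H := by
  have : stabR H (1 : M) H = ⊤ := by
    ext σ
    simp only [mem_stabR, Subgroup.mem_top, iff_true]
    exact ⟨σ, σ.2, by simp⟩
  rw [nRel, this, Subgroup.card_top]

variable [Finite M]

theorem nRel_pos (H : Subgroup Mˣ) (a : M) (K : Subgroup Mˣ) : 0 < nRel H a K :=
  Nat.card_pos

theorem DC.nR_pos {H K : Subgroup Mˣ} (D : DC H K) : 0 < D.nR := by
  induction D using DC.ind with | h a => exact nRel_pos _ _ _

theorem dvd_sum_of_invariant {P : Type*} [Group P] [Fintype P] (S : Subgroup P) (f : P → ℕ) (d : ℕ)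
    (hd : ∀ x, d ∣ f x) (hf : ∀ x, ∀ s ∈ S, f (x * s) = f x) : Nat.card S * d ∣ ∑ x, f x := by
  have e := (Subgroup.groupEquivQuotientProdSubgroup (s := S)).symm
  have hq : ∀ q : P ⧸ S, ∑ x ∈ Finset.univ.filter (fun x : P => (x : P ⧸ S) = q), f x
      = Nat.card S * f q.out := by
    intro q
    have h1 : ∀ x ∈ Finset.univ.filter (fun x : P => (x : P ⧸ S) = q), f x = f q.out := by
      intro x hx
      simp only [Finset.mem_filter, Finset.mem_univ, true_and] at hx
      have : ((q.out : P) : P ⧸ S) = (x : P ⧸ S) := by rw [hx]; exact Quotient.out_eq' q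
      rw [QuotientGroup.eq] at this
      have h2 := hf q.out _ this
      rwa [mul_inv_cancel_left] at h2
    rw [Finset.sum_congr rfl h1, Finset.sum_const, smul_eq_mul]
    congr 1
    rw [← Fintype.card_subtype, ← Nat.card_eq_fintype_card]
    refine Nat.card_congr
      { toFun := fun x => ⟨q.out⁻¹ * x.1, ?_⟩
        invFun := fun s => ⟨q.out * s.1, ?_⟩
        left_inv := fun x => by simp
        right_inv := fun s => by simp }
    · rw [← QuotientGroup.eq, x.2]; exact Quotient.out_eq' q
    · rw [QuotientGroup.mk_mul_of_mem _ s.2]; exact Quotient.out_eq' q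
  rw [← Finset.sum_fiberwise (s := Finset.univ) (g := fun x : P => (x : P ⧸ S))]
  refine Finset.dvd_sum fun q _ => ?_
  rw [hq]
  exact mul_dvd_mul_left _ (hd _)

theorem nR_mul_N_dvd {H K L : Subgroup Mˣ} (D₁ : DC H K) (D₂ : DC K L) (D : DC H L) :
    D₁.nR * D₂.nR ∣ D.nR * DC.N D₁ D₂ D := by
  induction D₁ using DC.ind with | h a => ?_
  induction D₂ using DC.ind with | h b => ?_
  induction D using DC.ind with | h g => ?_
  simp only [DC.nR_mk, DC.N_mk]
  let _ : Fintype H := Fintype.ofFinite _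
  let _ : Fintype K := Fintype.ofFinite _
  let P : H → K → Prop := fun σ ρ =>
    ∃ π ∈ L, ((σ : Mˣ) : M) * (a * ((ρ : Mˣ) : M) * b) = g * (π : M)
  have key : nRel H g L * NRel (K := K) a b (DC.mk H L g)
      = ∑ σ : H, ∑ ρ : K, if P σ ρ then 1 else 0 := by
    rw [Finset.sum_comm]
    have h1 : ∀ ρ : K, (∑ σ : H, if P σ ρ then 1 else 0)
        = if DC.mk H L (a * ((ρ : Mˣ) : M) * b) = DC.mk H L g then nRel H g L else 0 := by
      intro ρ
      split_ifs with h
      · rw [DC.mk_eq_iff] at h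
        rw [← nRel_congr h]
        obtain ⟨σ₀, hσ₀, π₀, hπ₀, e⟩ := h
        rw [Finset.sum_boole, ← Fintype.card_subtype, ← Nat.card_eq_fintype_card, Nat.cast_id]
        refine Nat.card_congr ((Equiv.mulLeft (⟨σ₀, hσ₀⟩ : H)⁻¹).subtypeEquiv fun σ => ?_)
        change P σ ρ ↔ (⟨σ₀, hσ₀⟩ : H)⁻¹ * σ ∈ stabR H _ L
        rw [mem_stabR]
        constructor
        · rintro ⟨π, hπ, h2⟩
          refine ⟨π₀ * π, L.mul_mem hπ₀ hπ, ?_⟩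
          rw [e] at h2
          calc ((((⟨σ₀, hσ₀⟩ : H)⁻¹ * σ : H) : Mˣ) : M) * (a * ((ρ : Mˣ) : M) * b)
              = ((σ₀⁻¹ : Mˣ) : M) * (((σ : Mˣ) : M) * (a * ((ρ : Mˣ) : M) * b)) := by
                simp [mul_assoc]
            _ = _ := by rw [h2]; simp [mul_assoc]
        · rintro ⟨π, hπ, h2⟩
          refine ⟨π₀⁻¹ * π, L.mul_mem (L.inv_mem hπ₀) hπ, ?_⟩
          rw [e]
          calc ((σ : Mˣ) : M) * (a * ((ρ : Mˣ) : M) * b)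
              = (σ₀ : M) * (((((⟨σ₀, hσ₀⟩ : H)⁻¹ * σ : H) : Mˣ) : M)
                  * (a * ((ρ : Mˣ) : M) * b)) := by
                simp [mul_assoc]
            _ = _ := by rw [h2]; simp [mul_assoc]
      · refine Finset.sum_eq_zero fun σ _ => if_neg ?_
        rintro ⟨π, hπ, e⟩
        refine h (DC.mk_eq_iff.2 ⟨σ, σ.2, π⁻¹, L.inv_mem hπ, ?_⟩)
        rw [e]; simp [mul_assoc]
    rw [Finset.sum_congr rfl fun ρ _ => h1 ρ, ← Finset.sum_filter, Finset.sum_const,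
      ← Fintype.card_subtype, ← Nat.card_eq_fintype_card, smul_eq_mul, mul_comm]
    rfl
  rw [key]
  refine dvd_sum_of_invariant (stabR H a K) _ _ ?_ ?_
  · intro σ
    have := dvd_sum_of_invariant (stabR K b L) (fun ρ => if P σ ρ then 1 else 0) 1
      (fun _ => one_dvd _) ?_
    · rwa [mul_one] at this
    · rintro ρ κ ⟨π, hπ, e⟩
      have : P σ (ρ * κ) ↔ P σ ρ := by
        have e2 : ((σ : Mˣ) : M) * (a * (((ρ * κ : K) : Mˣ) : M) * b)
            = ((σ : Mˣ) : M) * (a * ((ρ : Mˣ) : M) * b) * (π : M) := by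
          simp only [Subgroup.coe_mul, Units.val_mul, mul_assoc]
          rw [e]
        constructor
        · rintro ⟨θ, hθ, h⟩
          refine ⟨θ * π⁻¹, L.mul_mem hθ (L.inv_mem hπ), ?_⟩
          rw [e2] at h
          rw [Units.val_mul, ← mul_assoc g, ← h]; simp [mul_assoc]
        · rintro ⟨θ, hθ, h⟩
          refine ⟨θ * π, L.mul_mem hθ hπ, ?_⟩
          rw [e2, h]; simp [mul_assoc]
      simp only [this]
  · rintro σ τ ⟨π, hπ, e⟩
    refine Fintype.sum_equiv (Equiv.mulLeft (⟨π, hπ⟩ : K)) _ _ fun ρ => ?_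
    have : P (σ * τ) ρ ↔ P σ (⟨π, hπ⟩ * ρ) := by
      have e2 : (((σ * τ : H) : Mˣ) : M) * (a * ((ρ : Mˣ) : M) * b)
          = ((σ : Mˣ) : M) * (a * (((⟨π, hπ⟩ * ρ : K) : Mˣ) : M) * b) := by
        calc (((σ * τ : H) : Mˣ) : M) * (a * ((ρ : Mˣ) : M) * b)
            = ((σ : Mˣ) : M) * ((((τ : Mˣ) : M) * a) * ((ρ : Mˣ) : M) * b) := by
              simp [mul_assoc]
          _ = _ := by rw [e]; simp [mul_assoc]
      change (∃ _, _) ↔ (∃ _, _)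
      rw [e2]
    simp only [Equiv.coe_mulLeft, this]
    rfl

theorem structConst_mul {H K L : Subgroup Mˣ} (D₁ : DC H K) (D₂ : DC K L) (D : DC H L) :
    structConst D₁ D₂ D * (D₁.nR * D₂.nR) = D.nR * DC.N D₁ D₂ D :=
  Nat.div_mul_cancel (nR_mul_N_dvd D₁ D₂ D)

theorem sum_N_mul {H K L : Subgroup Mˣ} (a b : M) (g : DC H L → ℕ) [Fintype K] :
    ∑ E : DC H L, DC.N (DC.mk H K a) (DC.mk K L b) E * g E
      = ∑ ρ : K, g (DC.mk H L (a * ((ρ : Mˣ) : M) * b)) := by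
  rw [← Finset.sum_fiberwise (s := Finset.univ)
    (g := fun ρ : K => DC.mk H L (a * ((ρ : Mˣ) : M) * b))]
  refine Finset.sum_congr rfl fun E _ => ?_
  rw [Finset.sum_congr rfl (g := fun _ => g E) (fun ρ hρ => by
    rw [(Finset.mem_filter.1 hρ).2]), Finset.sum_const, smul_eq_mul, DC.N_mk, NRel,
    ← Fintype.card_subtype, Nat.card_eq_fintype_card]

theorem N_assoc {H K L J : Subgroup Mˣ} (D₁ : DC H K) (D₂ : DC K L) (D₃ : DC L J) (F : DC H J) :
    ∑ E : DC H L, DC.N D₁ D₂ E * DC.N E D₃ F = ∑ E : DC K J, DC.N D₂ D₃ E * DC.N D₁ E F := by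
  induction D₁ using DC.ind with | h a => ?_
  induction D₂ using DC.ind with | h b => ?_
  induction D₃ using DC.ind with | h c => ?_
  have : Fintype L := Fintype.ofFinite _
  have : Fintype K := Fintype.ofFinite _
  rw [sum_N_mul, sum_N_mul]
  simp only [N_eq_sum]
  rw [Finset.sum_comm]
  simp only [mul_assoc]

theorem structConst_assoc {H K L J : Subgroup Mˣ} (D₁ : DC H K) (D₂ : DC K L) (D₃ : DC L J)
    (F : DC H J) :
    ∑ E : DC H L, structConst D₁ D₂ E * structConst E D₃ F
      = ∑ E : DC K J, structConst D₂ D₃ E * structConst D₁ E F := by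
  have hpos : 0 < D₁.nR * D₂.nR * D₃.nR :=
    Nat.mul_pos (Nat.mul_pos D₁.nR_pos D₂.nR_pos) D₃.nR_pos
  apply Nat.eq_of_mul_eq_mul_right hpos
  have hl : (∑ E : DC H L, structConst D₁ D₂ E * structConst E D₃ F) * (D₁.nR * D₂.nR * D₃.nR)
      = F.nR * ∑ E : DC H L, DC.N D₁ D₂ E * DC.N E D₃ F := by
    rw [Finset.sum_mul, Finset.mul_sum]
    refine Finset.sum_congr rfl fun E _ => ?_
    apply Nat.eq_of_mul_eq_mul_right E.nR_pos
    calc structConst D₁ D₂ E * structConst E D₃ F * (D₁.nR * D₂.nR * D₃.nR) * E.nR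
        = (structConst D₁ D₂ E * (D₁.nR * D₂.nR)) * (structConst E D₃ F * (E.nR * D₃.nR)) := by
          ring
      _ = _ := by rw [structConst_mul, structConst_mul]; ring
  have hr : (∑ E : DC K J, structConst D₂ D₃ E * structConst D₁ E F) * (D₁.nR * D₂.nR * D₃.nR)
      = F.nR * ∑ E : DC K J, DC.N D₂ D₃ E * DC.N D₁ E F := by
    rw [Finset.sum_mul, Finset.mul_sum]
    refine Finset.sum_congr rfl fun E _ => ?_
    apply Nat.eq_of_mul_eq_mul_right E.nR_pos
    calc structConst D₂ D₃ E * structConst D₁ E F * (D₁.nR * D₂.nR * D₃.nR) * E.nR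
        = (structConst D₂ D₃ E * (D₂.nR * D₃.nR)) * (structConst D₁ E F * (D₁.nR * E.nR)) := by
          ring
      _ = _ := by rw [structConst_mul, structConst_mul]; ring
  rw [hl, hr, N_assoc]

theorem structConst_one_left {H K : Subgroup Mˣ} (D D' : DC H K) :
    structConst (DC.mk H H 1) D D' = if D = D' then 1 else 0 := by
  induction D using DC.ind with | h b => ?_
  have : Fintype H := Fintype.ofFinite _
  apply Nat.eq_of_mul_eq_mul_right (Nat.mul_pos (DC.mk H H (1 : M)).nR_pos (DC.mk H K b).nR_pos)
  rw [structConst_mul, N_eq_sum]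
  have : ∀ ρ : H, DC.mk H K (1 * ((ρ : Mˣ) : M) * b) = DC.mk H K b := fun ρ =>
    (DC.mk_eq_iff.2 ⟨ρ, ρ.2, 1, K.one_mem, by simp⟩).symm
  simp only [this]
  split_ifs with h
  · subst h
    simp [nRel_one, mul_comm]
  · simp

theorem structConst_one_right {H K : Subgroup Mˣ} (D D' : DC H K) :
    structConst D (DC.mk K K 1) D' = if D = D' then 1 else 0 := by
  induction D using DC.ind with | h b => ?_
  have : Fintype K := Fintype.ofFinite _
  apply Nat.eq_of_mul_eq_mul_right (Nat.mul_pos (DC.mk H K b).nR_pos (DC.mk K K (1 : M)).nR_pos)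
  rw [structConst_mul, N_eq_sum]
  have : ∀ ρ : K, DC.mk H K (b * ((ρ : Mˣ) : M) * 1) = DC.mk H K b := fun ρ =>
    (DC.mk_eq_iff.2 ⟨1, H.one_mem, ρ, ρ.2, by simp⟩).symm
  simp only [this]
  split_ifs with h
  · subst h
    simp [nRel_one]
  · simp

end DoubleCosets

/-! ### The right double coset algebra -/

section Algebra

variable {M : Type*} [Monoid M] {I : Type*}

/-- The right generalized Schur algebra over `R` attached to a monoid `M` and a family `G` of
groups of units: the free `R`-module with basis `f(l, D, m)`, where `l`, `m` are indices and `D` is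
a `G l`-`G m` double coset. An element is given by its coordinates in this basis. -/
def RGS (R : Type*) (G : I → Subgroup Mˣ) : Type _ := ∀ l m : I, DC (G l) (G m) → R

namespace RGS

variable {R : Type*} {G : I → Subgroup Mˣ}

theorem ext {x y : RGS R G} (h : ∀ l m D, x l m D = y l m D) : x = y :=
  funext fun l => funext fun m => funext fun D => h l m D

variable [CommRing R]

instance : AddCommGroup (RGS R G) :=
  inferInstanceAs (AddCommGroup (∀ l m : I, DC (G l) (G m) → R))

instance : Module R (RGS R G) :=
  inferInstanceAs (Module R (∀ l m : I, DC (G l) (G m) → R))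

/-- The basis element `f(l, D, m)`. -/
def f (R : Type*) [CommRing R] {G : I → Subgroup Mˣ} (l : I) (m : I) (D : DC (G l) (G m)) :
    RGS R G :=
  Pi.single l (Pi.single m (Pi.single D 1))

instance : One (RGS R G) where
  one := fun l m D => if l = m ∧ D = DC.mk (G l) (G m) 1 then 1 else 0

theorem one_apply (l m : I) (D : DC (G l) (G m)) :
    (1 : RGS R G) l m D = if l = m ∧ D = DC.mk (G l) (G m) 1 then 1 else 0 := rfl

@[simp] theorem add_apply (x y : RGS R G) (l m : I) (D : DC (G l) (G m)) :
    (x + y) l m D = x l m D + y l m D := rfl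

@[simp] theorem zero_apply (l m : I) (D : DC (G l) (G m)) : (0 : RGS R G) l m D = 0 := rfl

@[simp] theorem smul_apply (c : R) (x : RGS R G) (l m : I) (D : DC (G l) (G m)) :
    (c • x) l m D = c * x l m D := rfl

theorem f_self (l m : I) (D E : DC (G l) (G m)) : f R l m D l m E = if E = D then 1 else 0 := by
  simp [f, Pi.single_apply]

theorem f_of_ne_left {l l' : I} (h : l' ≠ l) (m m' : I) (D : DC (G l) (G m))
    (E : DC (G l') (G m')) : f R l m D l' m' E = 0 := by
  simp [f, h]

theorem f_of_ne_right {m m' : I} (h : m' ≠ m) (l : I) (D : DC (G l) (G m))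
    (E : DC (G l) (G m')) : f R l m D l m' E = 0 := by
  simp [f, h]

/-- The coordinate of an element at the basis vector `f(l, D, m)`. -/
def coord (R : Type*) [CommRing R] {G : I → Subgroup Mˣ} (l m : I) (D : DC (G l) (G m)) :
    RGS R G →+ R where
  toFun x := x l m D
  map_zero' := rfl
  map_add' _ _ := rfl

theorem sum_apply {T : Type*} (s : Finset T) (x : T → RGS R G) (l m : I) (D : DC (G l) (G m)) :
    (∑ t ∈ s, x t) l m D = ∑ t ∈ s, x t l m D :=
  map_sum (coord R l m D) x s

variable [Finite M]

theorem comp_assoc {H K L J : Subgroup Mˣ} (u : DC H K → R) (v : DC K L → R) (w : DC L J → R)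
    (F : DC H J) :
    ∑ E : DC H L, ∑ D₃ : DC L J, (structConst E D₃ F : R) *
        ((∑ D₁ : DC H K, ∑ D₂ : DC K L, (structConst D₁ D₂ E : R) * (u D₁ * v D₂)) * w D₃)
      = ∑ D₁ : DC H K, ∑ E : DC K J, (structConst D₁ E F : R) *
        (u D₁ * ∑ D₂ : DC K L, ∑ D₃ : DC L J, (structConst D₂ D₃ E : R) * (v D₂ * w D₃)) := by
  simp only [Finset.mul_sum, Finset.sum_mul]
  rw [Finset.sum_congr rfl fun E _ => Finset.sum_comm, Finset.sum_comm]
  refine Finset.sum_congr rfl fun D₁ _ => ?_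
  rw [Finset.sum_congr rfl fun E _ => Finset.sum_comm, Finset.sum_comm]
  conv_rhs => rw [Finset.sum_comm]
  refine Finset.sum_congr rfl fun D₂ _ => ?_
  rw [Finset.sum_comm]
  conv_rhs => rw [Finset.sum_comm]
  refine Finset.sum_congr rfl fun D₃ _ => ?_
  have h := congrArg (fun t : ℕ => (t : R) * (u D₁ * v D₂ * w D₃)) (structConst_assoc D₁ D₂ D₃ F)
  simp only [Nat.cast_sum, Nat.cast_mul, Finset.sum_mul] at h
  calc _ = _ := Finset.sum_congr rfl fun E _ => by ring
    _ = _ := h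
    _ = _ := Finset.sum_congr rfl fun E _ => by ring

variable [Fintype I]

/-- The product `*_R`: the bilinear extension of
`f(l, D₁, v) * f(v', D₂, m) = 0` for `v ≠ v'` and
`f(l, D₁, v) * f(v, D₂, m) = ∑ D, n_R(D) N(D₁, D₂, D) / (n_R(D₁) n_R(D₂)) f(l, D, m)`;
see `f_mul_f_of_ne` and `f_mul_f`. -/
instance : Mul (RGS R G) where
  mul x y := fun l m D => ∑ v, ∑ D₁ : DC (G l) (G v), ∑ D₂ : DC (G v) (G m),
    (structConst D₁ D₂ D : R) * (x l v D₁ * y v m D₂)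

theorem mul_apply (x y : RGS R G) (l m : I) (D : DC (G l) (G m)) :
    (x * y) l m D = ∑ v, ∑ D₁ : DC (G l) (G v), ∑ D₂ : DC (G v) (G m),
      (structConst D₁ D₂ D : R) * (x l v D₁ * y v m D₂) := rfl

theorem mul_assoc' (x y z : RGS R G) : x * y * z = x * (y * z) := by
  apply RGS.ext
  intro l m F
  have hl : (x * y * z) l m F = ∑ w, ∑ v, ∑ E : DC (G l) (G w), ∑ D₃ : DC (G w) (G m),
      (structConst E D₃ F : R) * ((∑ D₁ : DC (G l) (G v), ∑ D₂ : DC (G v) (G w),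
        (structConst D₁ D₂ E : R) * (x l v D₁ * y v w D₂)) * z w m D₃) := by
    rw [mul_apply]
    refine Finset.sum_congr rfl fun w _ => ?_
    conv_rhs => rw [Finset.sum_comm]
    refine Finset.sum_congr rfl fun E _ => ?_
    conv_rhs => rw [Finset.sum_comm]
    refine Finset.sum_congr rfl fun D₃ _ => ?_
    rw [mul_apply, Finset.sum_mul, Finset.mul_sum]
  have hr : (x * (y * z)) l m F = ∑ v, ∑ w, ∑ D₁ : DC (G l) (G v), ∑ E : DC (G v) (G m),
      (structConst D₁ E F : R) * (x l v D₁ * ∑ D₂ : DC (G v) (G w), ∑ D₃ : DC (G w) (G m),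
        (structConst D₂ D₃ E : R) * (y v w D₂ * z w m D₃)) := by
    rw [mul_apply]
    refine Finset.sum_congr rfl fun v _ => ?_
    conv_rhs => rw [Finset.sum_comm]
    refine Finset.sum_congr rfl fun D₁ _ => ?_
    conv_rhs => rw [Finset.sum_comm]
    refine Finset.sum_congr rfl fun E _ => ?_
    rw [mul_apply, Finset.mul_sum, Finset.mul_sum]
  rw [hl, hr, Finset.sum_comm]
  exact Finset.sum_congr rfl fun v _ => Finset.sum_congr rfl fun w _ => comp_assoc _ _ _ _

theorem one_mul' (x : RGS R G) : 1 * x = x := by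
  apply RGS.ext
  intro l m D
  rw [mul_apply, Finset.sum_eq_single l, Finset.sum_eq_single (DC.mk (G l) (G l) 1)]
  · simp [one_apply, structConst_one_left]
  · intro D₁ _ h
    simp [one_apply, h]
  · simp
  · intro v _ h
    simp [one_apply, h.symm]
  · simp

theorem mul_one' (x : RGS R G) : x * 1 = x := by
  apply RGS.ext
  intro l m D
  rw [mul_apply, Finset.sum_eq_single m, Finset.sum_comm,
    Finset.sum_eq_single (DC.mk (G m) (G m) 1)]
  · simp [one_apply, structConst_one_right]
  · intro D₁ _ h
    simp [one_apply, h]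
  · simp
  · intro v _ h
    simp [one_apply, h]
  · simp

instance : Ring (RGS R G) where
  __ := (inferInstance : AddCommGroup (RGS R G))
  mul_assoc := mul_assoc'
  one_mul := one_mul'
  mul_one := mul_one'
  zero_mul x := by apply RGS.ext; intro l m D; simp [mul_apply]
  mul_zero x := by apply RGS.ext; intro l m D; simp [mul_apply]
  left_distrib x y z := by
    apply RGS.ext; intro l m D
    simp [mul_apply, mul_add, Finset.sum_add_distrib]
  right_distrib x y z := by
    apply RGS.ext; intro l m D
    simp [mul_apply, mul_add, add_mul, Finset.sum_add_distrib]

instance : Algebra R (RGS R G) :=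
  Algebra.ofModule
    (fun c x y => by
      apply RGS.ext; intro l m D
      simp only [mul_apply, smul_apply, Finset.mul_sum]
      refine Finset.sum_congr rfl fun v _ => Finset.sum_congr rfl fun D₁ _ =>
        Finset.sum_congr rfl fun D₂ _ => by ring)
    (fun c x y => by
      apply RGS.ext; intro l m D
      simp only [mul_apply, smul_apply, Finset.mul_sum]
      refine Finset.sum_congr rfl fun v _ => Finset.sum_congr rfl fun D₁ _ =>
        Finset.sum_congr rfl fun D₂ _ => by ring)

theorem f_mul_f_of_ne {l v v' m : I} (h : v ≠ v') (D₁ : DC (G l) (G v)) (D₂ : DC (G v') (G m)) :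
    f R l v D₁ * f R v' m D₂ = 0 := by
  apply RGS.ext
  intro a b D
  rw [mul_apply, zero_apply]
  refine Finset.sum_eq_zero fun w _ => Finset.sum_eq_zero fun E₁ _ =>
    Finset.sum_eq_zero fun E₂ _ => ?_
  by_cases h2 : w = v'
  · subst h2
    by_cases h1 : a = l
    · subst h1
      rw [f_of_ne_right h.symm]; simp
    · rw [f_of_ne_left h1]; simp
  · rw [f_of_ne_left h2]; simp

theorem f_mul_f {l v m : I} (D₁ : DC (G l) (G v)) (D₂ : DC (G v) (G m)) :
    f R l v D₁ * f R v m D₂ = ∑ D : DC (G l) (G m), (structConst D₁ D₂ D : R) • f R l m D := by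
  apply RGS.ext
  intro a b D
  rw [sum_apply, mul_apply]
  simp only [smul_apply]
  by_cases h1 : a = l
  · subst h1
    by_cases h2 : b = m
    · subst h2
      rw [Finset.sum_eq_single v]
      · simp [f_self]
      · intro w _ h; simp [f_of_ne_right h]
      · simp
    · simp only [f_of_ne_right h2, mul_zero, Finset.sum_const_zero]
      refine Finset.sum_eq_zero fun w _ => Finset.sum_eq_zero fun E₁ _ =>
        Finset.sum_eq_zero fun E₂ _ => ?_
      by_cases h3 : w = v
      · subst h3
        rw [f_of_ne_right h2]; simp
      · rw [f_of_ne_left h3]; simp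
  · simp [f_of_ne_left h1]

/-- The idempotent `1_l = f(l, 1, l)`. -/
def idem (R : Type*) [CommRing R] (G : I → Subgroup Mˣ) (l : I) : RGS R G :=
  f R l l (DC.mk (G l) (G l) 1)

theorem idem_mul_f {l m : I} (D : DC (G l) (G m)) : idem R G l * f R l m D = f R l m D := by
  rw [idem, f_mul_f]
  simp [structConst_one_left]

theorem f_mul_idem {l m : I} (D : DC (G l) (G m)) : f R l m D * idem R G m = f R l m D := by
  rw [idem, f_mul_f]
  simp [structConst_one_right]

theorem isIdempotentElem_idem (l : I) : IsIdempotentElem (idem R G l) :=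
  idem_mul_f _

end RGS

end Algebra

/-! ### Corners of an algebra and their quotients -/

section Corner

variable {k A : Type*} [CommRing k] [Ring A] [Algebra k A] {e : A}

instance cornerSMul (he : IsIdempotentElem e) : SMul k he.Corner where
  smul c x := ⟨c • x.1, by
    obtain ⟨r, hr⟩ := x.2
    exact ⟨c • r, by rw [← hr]; simp⟩⟩

instance cornerModule (he : IsIdempotentElem e) : Module k he.Corner :=
  Function.Injective.module k
    ({ toFun := fun x => x.1, map_zero' := rfl, map_add' := fun _ _ => rfl } : he.Corner →+ A)
    Subtype.val_injective (fun _ _ => rfl)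

/-- The corner `e A e` is a `k`-algebra with unit `e`. -/
instance cornerAlgebra (he : IsIdempotentElem e) : Algebra k he.Corner :=
  Algebra.ofModule
    (fun c x y => Subtype.ext (smul_mul_assoc c x.1 y.1))
    (fun c x y => Subtype.ext (mul_smul_comm c x.1 y.1))

/-- The inclusion of `e A e` in `A`. -/
def cornerIncl (he : IsIdempotentElem e) : he.Corner →ₙ+* A where
  toFun x := x.1
  map_zero' := rfl
  map_add' _ _ := rfl
  map_mul' _ _ := rfl

end Corner

/-! ### Compositions, partitions and Young subgroups -/

/-- The set `Λ(r, n)` of compositions of `r` with `n` parts. -/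
def Comp (r n : ℕ) : Type := {l : Fin n → ℕ // ∑ i, l i = r}

section Compositions

variable {r n : ℕ}

instance : Fintype (Comp r n) :=
  Fintype.subtype (Finset.Nat.antidiagonalTuple n r)
    (fun _ => Finset.Nat.mem_antidiagonalTuple)

/-- The `i`-th block of `lam`. The integers `1, …, r` are represented by `0, …, r - 1`. -/
def block (lam : Comp r n) (i : Fin n) : Set (Fin r) :=
  {x | ∑ j ∈ Finset.Iio i, lam.1 j ≤ (x : ℕ) ∧ (x : ℕ) < ∑ j ∈ Finset.Iic i, lam.1 j}

/-- The parts of `lam` in decreasing order, that is, the partition equivalent to `lam`. -/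
def sorted (lam : Comp r n) : Fin n → ℕ := fun i => lam.1 (Tuple.sort lam.1 i.rev)

/-- `mu < lam`: the partition equivalent to `mu` is lexicographically smaller than the one
equivalent to `lam`. -/
def Comp.Lt (mu lam : Comp r n) : Prop :=
  ∃ k, (∀ i < k, sorted mu i = sorted lam i) ∧ sorted mu k < sorted lam k

end Compositions

/-- The full transformation semigroup `τ_r`; its group of units is the symmetric group. -/
abbrev Tau (r : ℕ) : Type := Function.End (Fin r)

instance (r : ℕ) : Finite (Tau r) := inferInstanceAs (Finite (Fin r → Fin r))

/-- The Young subgroup of `lam`: the permutations that map each block of `lam` to itself. -/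
def young {r n : ℕ} (lam : Comp r n) : Subgroup (Tau r)ˣ where
  carrier := {σ | ∀ i x, (σ : Tau r) x ∈ block lam i ↔ x ∈ block lam i}
  one_mem' _ _ := Iff.rfl
  mul_mem' := by
    intro σ τ hσ hτ i x
    exact (hσ i ((τ : Tau r) x)).trans (hτ i x)
  inv_mem' := by
    intro σ hσ i x
    have h := hσ i (((σ⁻¹ : (Tau r)ˣ) : Tau r) x)
    have e : (σ : Tau r) (((σ⁻¹ : (Tau r)ˣ) : Tau r) x) = x := congrFun σ.mul_inv x
    rw [e] at h
    exact h.symm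

/-! ### The algebras `B_R`, `1_λ B_R 1_λ` and `C_R^λ` for the monoid `τ_r` -/

section Schur

variable (k : Type*) [CommRing k] {r n : ℕ}

/-- The right generalized Schur algebra `B_R` over `k` for the monoid `τ_r`. -/
abbrev BR (k : Type*) (r n : ℕ) : Type _ := RGS k (young : Comp r n → Subgroup (Tau r)ˣ)

/-- The idempotent `1_λ` of `B_R`. -/
abbrev oneAt (lam : Comp r n) : BR k r n := RGS.idem k young lam

/-- `e_λ`, the sum of the `1_μ` with `μ < λ`. -/
def eBelow (lam : Comp r n) : BR k r n := ∑ mu with Comp.Lt mu lam, oneAt k mu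

theorem isIdempotentElem_oneAt (lam : Comp r n) : IsIdempotentElem (oneAt k lam) :=
  RGS.isIdempotentElem_idem lam

/-- `B_R^λ = 1_λ B_R 1_λ`, a `k`-algebra with unit `1_λ`. -/
abbrev BRAt (lam : Comp r n) : Type _ := (isIdempotentElem_oneAt k lam).Corner

/-- `B_R e_λ B_R`, the two-sided ideal of `B_R` generated by `e_λ`. -/
def idealBelow (lam : Comp r n) : TwoSidedIdeal (BR k r n) := TwoSidedIdeal.span {eBelow k lam}

/-- The two-sided ideal `B_R e_λ B_R ∩ B_R^λ` of `B_R^λ`. -/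
def idealAt (lam : Comp r n) : TwoSidedIdeal (BRAt k lam) :=
  TwoSidedIdeal.comap (cornerIncl (isIdempotentElem_oneAt k lam)) (idealBelow k lam)

/-- `C_R^λ = B_R^λ / (B_R e_λ B_R ∩ B_R^λ)`. -/
abbrev CR (lam : Comp r n) : Type _ := (idealAt k lam).ringCon.Quotient

/-- The projection `Π_R : B_R^λ → C_R^λ`. -/
def PiR (lam : Comp r n) : BRAt k lam →+* CR k lam := (idealAt k lam).ringCon.mk'

/-- The element `f(λ, α, λ)` of `B_R^λ`. -/
def fAt (lam : Comp r n) (a : Tau r) : BRAt k lam :=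
  ⟨RGS.f k lam lam (DC.mk _ _ a), (Subsemigroup.mem_corner_iff (isIdempotentElem_oneAt k lam)).2
    ⟨RGS.idem_mul_f _, RGS.f_mul_idem _⟩⟩

end Schur

/-! ### `p`-partitions and the homomorphism `φ_λ` -/

section PPartition

variable {r n : ℕ}

/-- `lam` is a partition all of whose nonzero parts are powers of `p`. -/
def IsPPartition (p : ℕ) (lam : Comp r n) : Prop :=
  Antitone lam.1 ∧ ∀ i, lam.1 i = 0 ∨ ∃ k, lam.1 i = p ^ k

/-- `s_i`, the number of parts of `lam` equal to `p ^ i`. -/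
def mult (p : ℕ) (lam : Comp r n) (i : ℕ) : ℕ := (Finset.univ.filter fun j => lam.1 j = p ^ i).card

/-- `c_i = ∑_{j > i} s_j p ^ j`, the number of integers in blocks of size greater than `p ^ i`
(`s_j = 0` for `j > r`). -/
def offset (p : ℕ) (lam : Comp r n) (i : ℕ) : ℕ := ∑ j ∈ Finset.Ioc i r, mult p lam j * p ^ j

theorem sum_mult {p : ℕ} (hp : p.Prime) {lam : Comp r n} (h : IsPPartition p lam) :
    ∑ i ∈ Finset.range (r + 1), mult p lam i * p ^ i = r := by
  have h1 : ∀ j, ∑ i ∈ Finset.range (r + 1), (if lam.1 j = p ^ i then p ^ i else 0) = lam.1 j := by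
    intro j
    rcases h.2 j with h0 | ⟨t, ht⟩
    · rw [h0]
      exact Finset.sum_eq_zero fun i _ => if_neg (pow_pos hp.pos i).ne
    · have hle : lam.1 j ≤ r := by
        conv_rhs => rw [← lam.2]
        exact Finset.single_le_sum (f := lam.1) (fun _ _ => Nat.zero_le _) (Finset.mem_univ j)
      have htr : t < r + 1 := by
        have := Nat.lt_pow_self hp.one_lt (n := t)
        omega
      rw [Finset.sum_eq_single t]
      · rw [if_pos ht, ht]
      · intro i _ hi
        refine if_neg fun e => hi ?_
        rw [ht] at e
        exact (Nat.pow_right_injective hp.two_le e).symm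
      · intro hn
        exact absurd (Finset.mem_range.2 htr) hn
  calc ∑ i ∈ Finset.range (r + 1), mult p lam i * p ^ i
      = ∑ i ∈ Finset.range (r + 1), ∑ j, (if lam.1 j = p ^ i then p ^ i else 0) := by
        refine Finset.sum_congr rfl fun i _ => ?_
        rw [← Finset.sum_filter, Finset.sum_const, smul_eq_mul, mult]
    _ = r := by rw [Finset.sum_comm, Finset.sum_congr rfl fun j _ => h1 j, lam.2]

theorem mult_eq_zero {p : ℕ} (hp : p.Prime) (lam : Comp r n) {i : ℕ} (hi : r < i) :
    mult p lam i = 0 := by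
  rw [mult, Finset.card_eq_zero, Finset.filter_eq_empty_iff]
  intro j _ e
  have hle : lam.1 j ≤ r := by
    conv_rhs => rw [← lam.2]
    exact Finset.single_le_sum (f := lam.1) (fun _ _ => Nat.zero_le _) (Finset.mem_univ j)
  have := Nat.lt_pow_self hp.one_lt (n := i)
  omega

theorem offset_anti {p : ℕ} (hp : p.Prime) (lam : Comp r n) {i j : ℕ} (h : i < j) :
    offset p lam j + mult p lam j * p ^ j ≤ offset p lam i := by
  by_cases hj : j ≤ r
  · rw [offset, offset, add_comm, ← Finset.sum_insert (f := fun j => mult p lam j * p ^ j) (by simp)]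
    refine Finset.sum_le_sum_of_subset fun x hx => ?_
    simp only [Finset.mem_insert, Finset.mem_Ioc] at hx ⊢
    omega
  · rw [mult_eq_zero hp lam (by omega), offset, Finset.Ioc_eq_empty (by omega)]
    simp

theorem offset_zero {p : ℕ} (hp : p.Prime) {lam : Comp r n} (h : IsPPartition p lam) :
    offset p lam 0 + mult p lam 0 * p ^ 0 = r := by
  conv_rhs => rw [← sum_mult hp h]
  rw [offset, add_comm, ← Finset.sum_insert (f := fun j => mult p lam j * p ^ j) (by simp)]
  refine Finset.sum_congr ?_ fun _ _ => rfl
  ext x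
  simp only [Finset.mem_insert, Finset.mem_Ioc, Finset.mem_range]
  omega

theorem offset_add_le {p : ℕ} (hp : p.Prime) {lam : Comp r n} (h : IsPPartition p lam) (i : ℕ) :
    offset p lam i + mult p lam i * p ^ i ≤ r := by
  rcases Nat.eq_zero_or_pos i with rfl | hi
  · exact (offset_zero hp h).le
  · have := offset_anti hp lam hi
    have := offset_zero hp h
    omega

theorem pos_lt {s q a b : ℕ} (ha : a < s) (hb : b < q) : a * q + b < s * q :=
  calc a * q + b < a * q + q := by omega
    _ = (a + 1) * q := by ring
    _ ≤ s * q := Nat.mul_le_mul_right q ha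

/-- The integer `c_i + a p ^ i + b`, the entry at place `b` of the `a`-th row of length `p ^ i`
(with `a`, `b` and the entries counted from `0`). -/
def posFun {p : ℕ} (hp : p.Prime) {lam : Comp r n} (h : IsPPartition p lam)
    (x : Σ i : ℕ, Fin (mult p lam i) × Fin (p ^ i)) : Fin r :=
  ⟨offset p lam x.1 + x.2.1 * p ^ x.1 + x.2.2, by
    have := offset_add_le hp h x.1
    have := pos_lt x.2.1.2 x.2.2.2
    omega⟩

theorem posFun_bijective {p : ℕ} (hp : p.Prime) {lam : Comp r n} (h : IsPPartition p lam) :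
    Function.Bijective (posFun hp h) := by
  constructor
  · rintro ⟨i, a, b⟩ ⟨j, a', b'⟩ e
    have e1 : offset p lam i + a * p ^ i + b = offset p lam j + a' * p ^ j + b' :=
      congrArg Fin.val e
    have h1 := pos_lt a.2 b.2
    have h2 := pos_lt a'.2 b'.2
    rcases lt_trichotomy i j with hij | rfl | hij
    · have := offset_anti hp lam hij
      omega
    · have e2 : (b : ℕ) + p ^ i * a = b' + p ^ i * a' := by
        rw [mul_comm _ (a : ℕ), mul_comm _ (a' : ℕ)]; omega
      have hb : (b : ℕ) = b' := by
        have := congrArg (· % p ^ i) e2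
        simpa [Nat.mod_eq_of_lt b.2, Nat.mod_eq_of_lt b'.2] using this
      have ha : (a : ℕ) = a' :=
        Nat.eq_of_mul_eq_mul_left (pow_pos hp.pos i) (by omega)
      rw [Fin.ext ha, Fin.ext hb]
    · have := offset_anti hp lam hij
      omega
  · intro x
    have hex : ∃ i, offset p lam i ≤ x := ⟨r, by simp [offset]⟩
    let i := Nat.find hex
    have hi : offset p lam i ≤ x := Nat.find_spec hex
    have hlt : (x : ℕ) < offset p lam i + mult p lam i * p ^ i := by
      rcases Nat.eq_zero_or_pos i with h0 | hpos
      · rw [h0, offset_zero hp h]; exact x.2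
      · have hm : ¬ offset p lam (i - 1) ≤ x := Nat.find_min hex (Nat.sub_lt hpos one_pos)
        have hle : offset p lam (i - 1) ≤ offset p lam i + mult p lam i * p ^ i := by
          have hsub : Finset.Ioc (i - 1) r ⊆ insert i (Finset.Ioc i r) := by
            intro y hy
            simp only [Finset.mem_insert, Finset.mem_Ioc] at hy ⊢
            omega
          calc offset p lam (i - 1) ≤ ∑ j ∈ insert i (Finset.Ioc i r), mult p lam j * p ^ j :=
                Finset.sum_le_sum_of_subset hsub
            _ = _ := by rw [Finset.sum_insert (by simp), add_comm]; rfl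
        omega
    have hq : 0 < p ^ i := pow_pos hp.pos i
    refine ⟨⟨i, ⟨(x - offset p lam i) / p ^ i, ?_⟩, ⟨(x - offset p lam i) % p ^ i,
      Nat.mod_lt _ hq⟩⟩, Fin.ext ?_⟩
    · rw [Nat.div_lt_iff_lt_mul hq]; omega
    · change offset p lam i + (x - offset p lam i) / p ^ i * p ^ i
        + (x - offset p lam i) % p ^ i = x
      have := Nat.div_add_mod' (x - offset p lam i) (p ^ i)
      omega

/-- Every entry lies at exactly one place of exactly one row. -/
def pos {p : ℕ} (hp : p.Prime) {lam : Comp r n} (h : IsPPartition p lam) :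
    (Σ i : ℕ, Fin (mult p lam i) × Fin (p ^ i)) ≃ Fin r :=
  Equiv.ofBijective (posFun hp h) (posFun_bijective hp h)

/-- `φ_λ` on `∏ τ_{s_i}` (the factors with `s_i = 0` are trivial): the image of `(α_i)` maps
`c_i + a p ^ i + b` to `c_i + α_i(a) p ^ i + b`, see `phi_pos`. -/
def phi {p : ℕ} (hp : p.Prime) {lam : Comp r n} (h : IsPPartition p lam) :
    (∀ i : ℕ, Tau (mult p lam i)) →* Tau r where
  toFun α := fun x => pos hp h (Sigma.map id (fun i => Prod.map (α i) id) ((pos hp h).symm x))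
  map_one' := by
    funext x
    change pos hp h ((pos hp h).symm x) = x
    simp
  map_mul' α β := by
    funext x
    change _ = pos hp h (Sigma.map id (fun i => Prod.map (α i) id) ((pos hp h).symm
      (pos hp h (Sigma.map id (fun i => Prod.map (β i) id) ((pos hp h).symm x)))))
    rw [Equiv.symm_apply_apply]
    rfl

theorem phi_pos {p : ℕ} (hp : p.Prime) {lam : Comp r n} (h : IsPPartition p lam)
    (α : ∀ i : ℕ, Tau (mult p lam i)) (i : ℕ) (a : Fin (mult p lam i)) (b : Fin (p ^ i)) :
    phi hp h α (pos hp h ⟨i, a, b⟩) = pos hp h ⟨i, α i a, b⟩ := by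
  change pos hp h (Sigma.map id _ ((pos hp h).symm (pos hp h ⟨i, a, b⟩))) = _
  rw [Equiv.symm_apply_apply]
  rfl

/-- `S_r^λ`, the image of `φ_λ`. -/
def SLam {p : ℕ} (hp : p.Prime) {lam : Comp r n} (h : IsPPartition p lam) : Submonoid (Tau r) :=
  MonoidHom.mrange (phi hp h)

/-- `S' = φ_λ(τ_{s_m} · ∏_{i > m} 𝔖_{s_i})`. It is used for the smallest `m` with `s_m ≠ 0`, so
that the factors with index below `m` are trivial. -/
def SPrime {p : ℕ} (hp : p.Prime) {lam : Comp r n} (h : IsPPartition p lam) (m : ℕ) :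
    Submonoid (Tau r) :=
  Submonoid.map (phi hp h)
    { carrier := {α : ∀ i, Tau (mult p lam i) | ∀ i, m < i →
        Function.Bijective (α i : Fin (mult p lam i) → Fin (mult p lam i))}
      one_mem' := fun _ _ => Function.bijective_id
      mul_mem' := fun hα hβ i hi => (hα i hi).comp (hβ i hi) }

theorem SPrime_le {p : ℕ} (hp : p.Prime) {lam : Comp r n} (h : IsPPartition p lam) (m : ℕ) :
    SPrime hp h m ≤ SLam hp h := by
  rintro _ ⟨α, _, rfl⟩
  exact ⟨α, rfl⟩

/-- The inclusion `k[S'] → k[S_r^λ]`. -/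
def inclPrime (k : Type*) [CommRing k] {p : ℕ} (hp : p.Prime) {lam : Comp r n}
    (h : IsPPartition p lam) (m : ℕ) :
    MonoidAlgebra k (SPrime hp h m) →ₐ[k] MonoidAlgebra k (SLam hp h) :=
  MonoidAlgebra.mapDomainAlgHom k k (Submonoid.inclusion (SPrime_le hp h m))

/-- The `k`-linear map `ψ_{λ,R} : k[S_r^λ] → B_R^λ` with `α ↦ f(λ, α, λ)`. -/
def psiR (k : Type*) [CommRing k] {p : ℕ} (hp : p.Prime) {lam : Comp r n}
    (h : IsPPartition p lam) : MonoidAlgebra k (SLam hp h) →ₗ[k] BRAt k lam :=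
  Finsupp.lsum k (fun α : SLam hp h => LinearMap.toSpanSingleton k _ (fAt k lam (α : Tau r))) ∘ₗ
    (MonoidAlgebra.coeffLinearEquiv k).toLinearMap

end PPartition

end GSchur

end

noncomputable section

namespace GSchur

open scoped Classical


/-! A basis element f(λ,α,λ) is governed by the numbers `cnt α c x t`: how many points of colour t
lie over x, where colours are block indices. These counts describe the coset α G_μ and the
stabilizer whose order is n_R. Call α row-constant (`RowConst`) if the count depends only on the
block of x; this says exactly that n_R is the full order of the left group. The order on
compositions is turned into an inequality between the integers `weight`, which makes sense for
arbitrary colourings, so that a colouring can serve as a middle index without first being sorted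
into a composition.

Surjectivity. Splitting a block lowers the weight, and r ≤ n supplies an empty part to receive the
new block. If α is not row-constant, splitting a block according to a count factors f(λ,α,λ) as
f(λ,1,c) f(c,α,λ) with coefficient 1, so it lies in the ideal. If α is row-constant but some block
is not mapped injectively into a single block, that block can be split on the source side keeping α
row-constant, and again f(λ,α,λ) lies in the ideal (`f_mul_mem_idealBelow`). What is left permutes
places inside rows and sends rows to rows of the same length, so up to double coset it is φ_λ(A). If
some A_i with i > m is not bijective, a row of length p^i is missed by the image. Folding that row
onto a row of length p^m does not change φ_λ(A), and the fold is not injective on the missed row, so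
the element is in the ideal too. Hence S' spans the quotient.

Injectivity. It suffices that p divides every structure constant at f(λ,α,λ), α ∈ S', for products
through some μ < λ (`prime_dvd_structConst`). As α is row-constant, such a constant is a multiple of
the index in G_λ of the stabilizer of the left factor β. If p does not divide that index, the
stabilizer is still transitive on every block, because blocks have p-power size, and therefore β is
row-constant. Moreover the image of β contains every block longer than p^m, because that of α does.
Superadditivity of N^x - 1 then gives weight λ ≤ weight μ, a contradiction
(`weight_le_weight_of_rowConst`).

On S_r^λ all stabilizers are full, so f(λ,α,λ) multiplies as α does; this makes the bijection an
algebra map. The tensor form follows by comparing bases. -/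

/-! ### Colourings and their automorphism groups -/

section Colourings

variable {r n : ℕ}

/-- The transformations underlying units are the permutations. -/
def unitOf (π : Equiv.Perm (Fin r)) : (Tau r)ˣ := Equiv.Perm.equivUnitsEnd π

@[simp] theorem unitOf_apply (π : Equiv.Perm (Fin r)) (x : Fin r) : (unitOf π : Tau r) x = π x :=
  rfl

theorem tau_mul_apply (a b : Tau r) (x : Fin r) : (a * b) x = a (b x) := rfl

@[simp] theorem unit_inv_apply_self (σ : (Tau r)ˣ) (x : Fin r) :
    ((σ⁻¹ : (Tau r)ˣ) : Tau r) ((σ : Tau r) x) = x := congrFun σ.inv_mul x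

@[simp] theorem unit_apply_inv_self (σ : (Tau r)ˣ) (x : Fin r) :
    (σ : Tau r) (((σ⁻¹ : (Tau r)ˣ) : Tau r) x) = x := congrFun σ.mul_inv x

/-- The permutation underlying a unit. -/
def permOf (σ : (Tau r)ˣ) : Equiv.Perm (Fin r) where
  toFun := (σ : Tau r)
  invFun := ((σ⁻¹ : (Tau r)ˣ) : Tau r)
  left_inv := unit_inv_apply_self σ
  right_inv := unit_apply_inv_self σ

@[simp] theorem permOf_apply (σ : (Tau r)ˣ) (x : Fin r) : permOf σ x = (σ : Tau r) x := rfl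

/-- The permutations preserving a colouring. -/
def colGrp {ι : Type*} (c : Fin r → ι) : Subgroup (Tau r)ˣ where
  carrier := {σ | ∀ x, c ((σ : Tau r) x) = c x}
  one_mem' _ := rfl
  mul_mem' := by
    intro σ τ hσ hτ x
    exact (hσ _).trans (hτ x)
  inv_mem' := by
    intro σ hσ x
    have := hσ (((σ⁻¹ : (Tau r)ˣ) : Tau r) x)
    rw [unit_apply_inv_self] at this
    exact this.symm

theorem mem_colGrp {ι : Type*} {c : Fin r → ι} {σ : (Tau r)ˣ} :
    σ ∈ colGrp c ↔ ∀ x, c ((σ : Tau r) x) = c x := Iff.rfl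

theorem exists_perm_of_card_fiber_eq {X Y : Type*} [Fintype X] [DecidableEq Y] (f g : X → Y)
    (h : ∀ y, (Finset.univ.filter fun x => f x = y).card
      = (Finset.univ.filter fun x => g x = y).card) :
    ∃ π : Equiv.Perm X, ∀ x, g (π x) = f x := by
  have e : ∀ y, Nonempty ({x // f x = y} ≃ {x // g x = y}) := fun y =>
    ⟨Fintype.equivOfCardEq (by rw [Fintype.card_subtype, Fintype.card_subtype, h y])⟩
  refine ⟨(Equiv.sigmaFiberEquiv f).symm.trans ((Equiv.sigmaCongrRight fun y =>
    (e y).some).trans (Equiv.sigmaFiberEquiv g)), fun x => ?_⟩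
  exact ((e (f x)).some ⟨x, rfl⟩).2

/-- The number of points of colour `t` in the fibre of `a` at `x`. -/
def cnt {ι : Type*} (a : Tau r) (c : Fin r → ι) (x : Fin r) (t : ι) : ℕ :=
  (Finset.univ.filter fun y => a y = x ∧ c y = t).card

theorem cnt_pos {ι : Type*} {a : Tau r} {c : Fin r → ι} {x : Fin r} {t : ι} :
    0 < cnt a c x t ↔ ∃ y, a y = x ∧ c y = t := by
  simp [cnt, Finset.card_pos, Finset.Nonempty]

/-- A permutation carrying the pairs (b y, c y) to the pairs (a y, c y) exists exactly when both
pair maps have fibres of equal size. -/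
theorem exists_mul_eq_mul_iff {ι : Type*} (a b : Tau r) (c : Fin r → ι) :
    (∃ π ∈ colGrp c, b = a * (π : Tau r)) ↔ ∀ x t, cnt b c x t = cnt a c x t := by
  constructor
  · rintro ⟨π, hπ, rfl⟩ x t
    refine Finset.card_equiv (permOf π) fun y => ?_
    simp [tau_mul_apply, hπ y]
  · intro h
    obtain ⟨π, hπ⟩ := exists_perm_of_card_fiber_eq (fun y => (b y, c y)) (fun y => (a y, c y))
      (by rintro ⟨x, t⟩; simpa [Prod.ext_iff, cnt] using h x t)
    simp only [Prod.ext_iff] at hπ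
    exact ⟨unitOf π, fun y => (hπ y).2, funext fun y => (hπ y).1.symm⟩

theorem cnt_unit_mul {ι : Type*} (σ : (Tau r)ˣ) (a : Tau r) (c : Fin r → ι) (x : Fin r) (t : ι) :
    cnt ((σ : Tau r) * a) c ((σ : Tau r) x) t = cnt a c x t := by
  unfold cnt
  congr 1
  ext y
  simp only [Finset.mem_filter, Finset.mem_univ, true_and, tau_mul_apply]
  rw [show (σ : Tau r) (a y) = (σ : Tau r) x ↔ a y = x from (permOf σ).injective.eq_iff]

/-- Left multiplication by σ moves the fibre over x to the fibre over σ x, so this is the previous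
criterion for σ a. It turns stabilizers, and hence n_R, into statements about counts. -/
theorem exists_unit_mul_eq_mul_iff {ι : Type*} (σ : (Tau r)ˣ) (a : Tau r) (c : Fin r → ι) :
    (∃ π ∈ colGrp c, (σ : Tau r) * a = a * (π : Tau r))
      ↔ ∀ x t, cnt a c ((σ : Tau r) x) t = cnt a c x t := by
  rw [exists_mul_eq_mul_iff]
  constructor
  · intro h x t
    rw [← h, cnt_unit_mul]
  · intro h x t
    have := h (((σ⁻¹ : (Tau r)ˣ) : Tau r) x) t
    rw [unit_apply_inv_self] at this
    rw [this]
    conv_lhs => rw [← unit_apply_inv_self σ x]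
    exact cnt_unit_mul _ _ _ _ _

theorem exists_mem_colGrp_apply {ι : Type*} {c : Fin r → ι} {x x' : Fin r} (h : c x = c x') :
    ∃ σ ∈ colGrp c, (σ : Tau r) x = x' := by
  refine ⟨unitOf (Equiv.swap x x'), fun y => ?_, by simp⟩
  rw [unitOf_apply, Equiv.swap_apply_def]
  split_ifs with h1 h2
  · rw [h1, h]
  · rw [h2, h]
  · rfl

/-- The fibres of `a`, coloured by `c`, depend only on the colour in `b`. -/
def RowConst {ι κ : Type*} (b : Fin r → ι) (a : Tau r) (c : Fin r → κ) : Prop :=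
  ∀ x x' t, b x = b x' → cnt a c x t = cnt a c x' t

/-- The colour classes of b are the orbits of `colGrp b`, so constancy on classes is invariance
under the group. By `nRel_eq_card` the right side says that n_R is maximal. -/
theorem rowConst_iff {ι κ : Type*} {b : Fin r → ι} {a : Tau r} {c : Fin r → κ} :
    RowConst b a c ↔
      ∀ σ ∈ colGrp b, ∃ π ∈ colGrp c, (σ : Tau r) * a = a * (π : Tau r) := by
  simp only [exists_unit_mul_eq_mul_iff]
  constructor
  · intro h σ hσ x t
    exact h _ _ _ (hσ x)
  · intro h x x' t hx
    obtain ⟨σ, hσ, rfl⟩ := exists_mem_colGrp_apply hx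
    exact (h σ hσ x t).symm

theorem RowConst.mul {ι κ θ : Type*} {b : Fin r → ι} {c : Fin r → κ} {d : Fin r → θ}
    {a a' : Tau r} (h : RowConst b a c) (h' : RowConst c a' d) : RowConst b (a * a') d := by
  rw [rowConst_iff] at *
  intro σ hσ
  obtain ⟨π, hπ, e⟩ := h σ hσ
  obtain ⟨π', hπ', e'⟩ := h' π hπ
  exact ⟨π', hπ', by rw [← mul_assoc, e, mul_assoc, e', mul_assoc]⟩

theorem nRel_eq_card {M : Type*} [Monoid M] [Finite M] {H K : Subgroup Mˣ} {a : M} :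
    nRel H a K = Nat.card H ↔ ∀ σ ∈ H, ∃ π ∈ K, (σ : M) * a = a * (π : M) := by
  rw [nRel, Subgroup.card_eq_iff_eq_top, Subgroup.eq_top_iff']
  simp only [mem_stabR, Subtype.forall]

theorem RowConst.nRel_eq {ι κ : Type*} {b : Fin r → ι} {a : Tau r} {c : Fin r → κ}
    (h : RowConst b a c) : nRel (colGrp b) a (colGrp c) = Nat.card (colGrp b) :=
  nRel_eq_card.2 (rowConst_iff.1 h)

/-- The sizes of the colour classes, weighted so that refining a colouring decreases the weight. -/
def weight (c : Fin r → Fin n) : ℕ :=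
  ∑ i, (n + 1) ^ (Finset.univ.filter fun x => c x = i).card

end Colourings

/-! ### Compositions as colourings -/

section Blocks

variable {r n : ℕ}

theorem exists_mem_block (lam : Comp r n) (x : Fin r) : ∃ i, x ∈ block lam i := by
  have hne : (Finset.univ.filter fun i : Fin n =>
      (x : ℕ) < ∑ j ∈ Finset.Iic i, lam.1 j).Nonempty := by
    have hn : 0 < n := by
      rcases Nat.eq_zero_or_pos n with rfl | h
      · have h0 : r = 0 := by simpa using lam.2.symm
        exact absurd x.2 (by omega)
      · exact h
    refine ⟨⟨n - 1, by omega⟩, ?_⟩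
    simp only [Finset.mem_filter, Finset.mem_univ, true_and]
    have : Finset.Iic (⟨n - 1, by omega⟩ : Fin n) = Finset.univ := by
      ext j
      simp only [Finset.mem_Iic, Finset.mem_univ, iff_true, Fin.le_def]
      omega
    rw [this, lam.2]
    exact x.2
  refine ⟨Finset.min' _ hne, ?_, ?_⟩
  · set i := Finset.min' _ hne with hi
    rcases Nat.eq_zero_or_pos i.1 with h0 | hpos
    · rw [Finset.sum_eq_zero]
      · exact Nat.zero_le _
      · intro j hj
        rw [Finset.mem_Iio, Fin.lt_def] at hj
        omega
    · by_contra hlt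
      have hmem : (⟨i.1 - 1, by omega⟩ : Fin n) ∈ Finset.univ.filter fun i : Fin n =>
          (x : ℕ) < ∑ j ∈ Finset.Iic i, lam.1 j := by
        simp only [Finset.mem_filter, Finset.mem_univ, true_and]
        have : Finset.Iic (⟨i.1 - 1, by omega⟩ : Fin n) = Finset.Iio i := by
          ext j
          simp only [Finset.mem_Iic, Finset.mem_Iio, Fin.le_def, Fin.lt_def]
          omega
        rw [this]
        omega
      have := Finset.min'_le _ _ hmem
      rw [← hi, Fin.le_def] at this
      simp only at this
      omega
  · have := Finset.min'_mem _ hne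
    simp only [Finset.mem_filter, Finset.mem_univ, true_and] at this
    exact this

theorem eq_of_mem_block {lam : Comp r n} {x : Fin r} {i j : Fin n} (hi : x ∈ block lam i)
    (hj : x ∈ block lam j) : i = j := by
  have key : ∀ {i j : Fin n}, x ∈ block lam i → x ∈ block lam j → ¬ i < j := by
    intro i j hi hj h
    have : ∑ t ∈ Finset.Iic i, lam.1 t ≤ ∑ t ∈ Finset.Iio j, lam.1 t :=
      Finset.sum_le_sum_of_subset fun t ht => by
        rw [Finset.mem_Iic] at ht
        exact Finset.mem_Iio.2 (ht.trans_lt h)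
    have h1 := hi.2
    have h2 := hj.1
    omega
  exact le_antisymm (not_lt.1 (key hj hi)) (not_lt.1 (key hi hj))

/-- The index of the block containing `x`. -/
def blk (lam : Comp r n) (x : Fin r) : Fin n := (exists_mem_block lam x).choose

theorem mem_block_iff {lam : Comp r n} {x : Fin r} {i : Fin n} :
    x ∈ block lam i ↔ blk lam x = i :=
  ⟨fun h => eq_of_mem_block (exists_mem_block lam x).choose_spec h,
    fun h => h ▸ (exists_mem_block lam x).choose_spec⟩

/-- Young subgroups are colouring groups; the converse, up to conjugation, comes from
`exists_blk_comp_perm`. -/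
theorem young_eq (lam : Comp r n) : young lam = colGrp (blk lam) := by
  ext σ
  change (∀ i x, (σ : Tau r) x ∈ block lam i ↔ x ∈ block lam i) ↔ _
  simp only [mem_block_iff, mem_colGrp]
  constructor
  · intro h x
    exact (h _ x).2 rfl
  · intro h i x
    rw [h x]

theorem card_blk (lam : Comp r n) (i : Fin n) :
    (Finset.univ.filter fun x => blk lam x = i).card = lam.1 i := by
  simp only [← mem_block_iff, block, Set.mem_ofPred_eq]
  have hi : ∑ j ∈ Finset.Iic i, lam.1 j = lam.1 i + ∑ j ∈ Finset.Iio i, lam.1 j := by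
    rw [← Finset.Iio_insert, Finset.sum_insert (by simp)]
  have hr : ∑ j ∈ Finset.Iic i, lam.1 j ≤ r := by
    conv_rhs => rw [← lam.2]
    exact Finset.sum_le_sum_of_subset (Finset.subset_univ _)
  rw [← Finset.card_map Fin.valEmbedding]
  have : (Finset.univ.filter fun x : Fin r => ∑ j ∈ Finset.Iio i, lam.1 j ≤ (x : ℕ) ∧
      (x : ℕ) < ∑ j ∈ Finset.Iic i, lam.1 j).map Fin.valEmbedding
      = Finset.Ico (∑ j ∈ Finset.Iio i, lam.1 j) (∑ j ∈ Finset.Iic i, lam.1 j) := by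
    ext y
    simp only [Finset.mem_map, Finset.mem_filter, Finset.mem_univ, true_and, Finset.mem_Ico,
      Fin.valEmbedding_apply]
    constructor
    · rintro ⟨x, hx, rfl⟩
      exact hx
    · intro hy
      exact ⟨⟨y, by omega⟩, hy, rfl⟩
  rw [this, Nat.card_Ico]
  omega

theorem weight_blk (lam : Comp r n) : weight (blk lam) = ∑ i, (n + 1) ^ lam.1 i := by
  simp only [weight, card_blk]

theorem sum_sorted (lam : Comp r n) (F : ℕ → ℕ) : ∑ i, F (sorted lam i) = ∑ i, F (lam.1 i) :=
  (Equiv.sum_comp (Fin.revPerm.trans (Tuple.sort lam.1)) fun i => F (lam.1 i))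

theorem sorted_antitone (lam : Comp r n) : Antitone (sorted lam) := fun _ _ h =>
  Tuple.monotone_sort lam.1 (Fin.rev_le_rev.2 h)

/-- There are at most n parts from the first difference on, so with base n + 1 the larger part at
that place outweighs all of them together. -/
theorem weight_lt_of_lt {mu lam : Comp r n} (h : Comp.Lt mu lam) :
    weight (blk mu) < weight (blk lam) := by
  obtain ⟨k, hk, hlt⟩ := h
  rw [weight_blk, weight_blk, ← sum_sorted mu fun x => (n + 1) ^ x,
    ← sum_sorted lam fun x => (n + 1) ^ x,
    ← Finset.sum_filter_add_sum_filter_not Finset.univ (fun i => i < k),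
    ← Finset.sum_filter_add_sum_filter_not (s := Finset.univ) (p := fun i => i < k)
      (f := fun i => (n + 1) ^ sorted lam i),
    Finset.sum_congr rfl (g := fun i => (n + 1) ^ sorted lam i) fun i hi => by
      rw [hk i (Finset.mem_filter.1 hi).2]]
  refine Nat.add_lt_add_left ?_ _
  have h1 : ∑ i with ¬ i < k, (n + 1) ^ sorted mu i ≤ n * (n + 1) ^ sorted mu k := by
    refine (Finset.sum_le_card_nsmul _ _ ((n + 1) ^ sorted mu k) fun i hi => ?_).trans ?_
    · exact Nat.pow_le_pow_right (Nat.succ_pos n)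
        (sorted_antitone mu (not_lt.1 (Finset.mem_filter.1 hi).2))
    · rw [smul_eq_mul]
      exact Nat.mul_le_mul_right _ ((Finset.card_le_univ _).trans (by simp))
  have h2 : (n + 1) ^ sorted lam k ≤ ∑ i with ¬ i < k, (n + 1) ^ sorted lam i :=
    Finset.single_le_sum (f := fun i => (n + 1) ^ sorted lam i) (fun _ _ => Nat.zero_le _)
      (by simp)
  have h3 : (n + 1) ^ (sorted mu k + 1) ≤ (n + 1) ^ sorted lam k :=
    Nat.pow_le_pow_right (Nat.succ_pos n) hlt
  have h4 : 0 < (n + 1) ^ sorted mu k := by positivity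
  rw [pow_succ] at h3
  nlinarith

/-- The lexicographic order on sorted sequences is total and the weight depends only on the sorted
sequence, so the converse follows from `weight_lt_of_lt`. -/
theorem lt_of_weight_lt {mu lam : Comp r n} (h : weight (blk mu) < weight (blk lam)) :
    Comp.Lt mu lam := by
  by_cases heq : sorted mu = sorted lam
  · rw [weight_blk, weight_blk, ← sum_sorted mu fun x => (n + 1) ^ x,
      ← sum_sorted lam fun x => (n + 1) ^ x, heq] at h
    exact absurd h (lt_irrefl _)
  · have hne : (Finset.univ.filter fun i => sorted mu i ≠ sorted lam i).Nonempty := by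
      obtain ⟨i, hi⟩ := Function.ne_iff.1 heq
      exact ⟨i, by simpa using hi⟩
    set k := Finset.min' _ hne with hk
    have h1 : sorted mu k ≠ sorted lam k := (Finset.mem_filter.1 (Finset.min'_mem _ hne)).2
    have h2 : ∀ i < k, sorted mu i = sorted lam i := by
      intro i hi
      by_contra hc
      exact absurd (Finset.min'_le _ i (by simpa using hc)) (not_le.2 hi)
    rcases lt_or_gt_of_ne h1 with h3 | h3
    · exact ⟨k, h2, h3⟩
    · exact absurd h (weight_lt_of_lt ⟨k, fun i hi => (h2 i hi).symm, h3⟩).asymm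

/-- Every colouring is, up to a permutation, the block colouring of a composition. -/
theorem exists_blk_comp_perm (c : Fin r → Fin n) :
    ∃ (mu : Comp r n) (u : (Tau r)ˣ), ∀ x, blk mu ((u : Tau r) x) = c x := by
  let mu : Comp r n := ⟨fun i => (Finset.univ.filter fun x => c x = i).card, by
    rw [← Finset.card_eq_sum_card_fiberwise (fun x _ => Finset.mem_univ (c x))]; simp⟩
  obtain ⟨π, hπ⟩ := exists_perm_of_card_fiber_eq c (blk mu) fun i => (card_blk mu i).symm
  exact ⟨mu, unitOf π, hπ⟩

theorem weight_comp_unit (c : Fin r → Fin n) (u : (Tau r)ˣ) :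
    weight (fun x => c ((u : Tau r) x)) = weight c := by
  unfold weight
  refine Finset.sum_congr rfl fun i _ => ?_
  congr 1
  exact Finset.card_equiv (permOf u) fun x => by simp

end Blocks


/-! ### Products of basis elements and the ideal `B_R e_λ B_R` -/

section Products

variable {M : Type*} [Monoid M]

theorem NRel_mk_of_forall {H K L : Subgroup Mˣ} {a b : M}
    (h : ∀ ρ ∈ K, DC.mk H L (a * (ρ : M) * b) = DC.mk H L (a * b)) (D : DC H L) :
    NRel (K := K) a b D = if D = DC.mk H L (a * b) then Nat.card K else 0 := by
  unfold NRel
  split_ifs with hD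
  · subst hD
    exact Nat.card_congr (Equiv.subtypeUnivEquiv fun ρ => h ρ ρ.2)
  · rw [Nat.card_eq_zero]
    exact .inl ⟨fun ρ => hD (ρ.2.symm.trans (h _ ρ.1.2))⟩

/-- All ρ land in a single double coset, so N is the order of K there and 0 elsewhere; `hn` makes
the quotient 1. -/
theorem structConst_eq_ite [Finite M] {H K L : Subgroup Mˣ} {a b : M}
    (h : ∀ ρ ∈ K, DC.mk H L (a * (ρ : M) * b) = DC.mk H L (a * b))
    (hn : nRel H (a * b) L * Nat.card K = nRel H a K * nRel K b L) (D : DC H L) :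
    structConst (DC.mk H K a) (DC.mk K L b) D = if D = DC.mk H L (a * b) then 1 else 0 := by
  apply Nat.eq_of_mul_eq_mul_right (Nat.mul_pos (DC.mk H K a).nR_pos (DC.mk K L b).nR_pos)
  rw [structConst_mul, DC.N_mk, NRel_mk_of_forall h]
  split_ifs with hD
  · subst hD
    rw [DC.nR_mk, DC.nR_mk, DC.nR_mk, hn, one_mul]
  · simp

theorem f_mul_f_eq_f [Finite M] {I R : Type*} [CommRing R] [Fintype I] {G : I → Subgroup Mˣ}
    {l v m : I} {a b : M}
    (h : ∀ ρ ∈ G v, DC.mk (G l) (G m) (a * (ρ : M) * b) = DC.mk (G l) (G m) (a * b))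
    (hn : nRel (G l) (a * b) (G m) * Nat.card (G v) = nRel (G l) a (G v) * nRel (G v) b (G m)) :
    RGS.f R l v (DC.mk (G l) (G v) a) * RGS.f R v m (DC.mk (G v) (G m) b)
      = RGS.f R l m (DC.mk (G l) (G m) (a * b)) := by
  rw [RGS.f_mul_f]
  simp [structConst_eq_ite h hn]

theorem nRel_mul_unit_inv {H K K' : Subgroup Mˣ} {u : Mˣ} (hK : ∀ κ, κ ∈ K ↔ u * κ * u⁻¹ ∈ K')
    (a : M) : nRel H (a * ((u⁻¹ : Mˣ) : M)) K' = nRel H a K := by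
  have : stabR H (a * ((u⁻¹ : Mˣ) : M)) K' = stabR H a K := by
    ext σ
    rw [mem_stabR, mem_stabR]
    constructor
    · rintro ⟨π, hπ, e⟩
      refine ⟨u⁻¹ * π * u, (hK _).2 (by simpa [mul_assoc] using hπ), ?_⟩
      have := congrArg (fun x => x * (u : M)) e
      simpa [mul_assoc] using this
    · rintro ⟨π, hπ, e⟩
      refine ⟨u * π * u⁻¹, (hK _).1 hπ, ?_⟩
      rw [← mul_assoc, e]
      simp [mul_assoc]
  rw [nRel, nRel, this]

/-- Groups of units conjugate by `u` are isomorphic. -/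
def conjEquiv {K K' : Subgroup Mˣ} (u : Mˣ) (hK : ∀ κ, κ ∈ K ↔ u * κ * u⁻¹ ∈ K') : K ≃ K' :=
  (MulAut.conj u).toEquiv.subtypeEquiv hK

theorem nRel_unit_mul {L K K' : Subgroup Mˣ} {u : Mˣ} (hK : ∀ κ, κ ∈ K ↔ u * κ * u⁻¹ ∈ K')
    (b : M) : nRel K' ((u : M) * b) L = nRel K b L := by
  refine (Nat.card_congr ((conjEquiv u hK).subtypeEquiv fun κ => ?_)).symm
  change κ ∈ stabR K b L ↔ conjEquiv u hK κ ∈ stabR K' _ L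
  rw [mem_stabR, mem_stabR]
  refine exists_congr fun π => and_congr_right fun _ => ?_
  change _ ↔ ((u * κ * u⁻¹ : Mˣ) : M) * ((u : M) * b) = _
  simp only [Units.val_mul, mul_assoc, Units.inv_mul_cancel_left, Units.mul_right_inj]

end Products

section Ideal

variable (k : Type*) [CommRing k] {r n : ℕ}

/-- Between the two factors e_λ acts as 1_μ: the other summands of e_λ annihilate the left factor.
-/
theorem f_mem_idealBelow {lam mu : Comp r n} (h : Comp.Lt mu lam) {l v : Comp r n}
    (D₁ : DC (young l) (young mu)) (D₂ : DC (young mu) (young v)) :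
    RGS.f k l mu D₁ * RGS.f k mu v D₂ ∈ idealBelow k lam := by
  have : RGS.f k l mu D₁ * RGS.f k mu v D₂
      = RGS.f k l mu D₁ * eBelow k lam * RGS.f k mu v D₂ := by
    rw [eBelow, Finset.mul_sum, Finset.sum_eq_single mu]
    · rw [RGS.f_mul_idem]
    · intro w _ hw
      exact RGS.f_mul_f_of_ne hw.symm _ _
    · intro hmu
      exact absurd (by simpa using h) hmu
  rw [this]
  exact TwoSidedIdeal.mul_mem_right _ _ _ (TwoSidedIdeal.mul_mem_left _ _ _
    (TwoSidedIdeal.subset_span rfl))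

/-- A basis element that factors through a colouring of smaller weight lies in the ideal. -/
theorem f_mem_idealBelow_of_factor {lam : Comp r n} {c : Fin r → Fin n}
    (hc : weight c < weight (blk lam)) {a b : Tau r}
    (h : ∀ ρ ∈ colGrp c, DC.mk (young lam) (young lam) (a * (ρ : Tau r) * b)
      = DC.mk (young lam) (young lam) (a * b))
    (hn : nRel (young lam) (a * b) (young lam) * Nat.card (colGrp c)
      = nRel (young lam) a (colGrp c) * nRel (colGrp c) b (young lam)) :
    RGS.f k lam lam (DC.mk _ _ (a * b)) ∈ idealBelow k lam := by
  obtain ⟨mu, u, hu⟩ := exists_blk_comp_perm c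
  have hK : ∀ κ, κ ∈ colGrp c ↔ u * κ * u⁻¹ ∈ young mu := by
    intro κ
    rw [young_eq, mem_colGrp, mem_colGrp]
    simp only [Units.val_mul, tau_mul_apply, hu]
    constructor
    · intro h x
      rw [h, ← hu, unit_apply_inv_self]
    · intro h x
      have := h ((u : Tau r) x)
      rwa [unit_inv_apply_self, hu] at this
  have hlt : Comp.Lt mu lam := by
    refine lt_of_weight_lt ?_
    rwa [← weight_comp_unit (blk mu) u, funext hu]
  -- Inserting u⁻¹ u between the factors replaces the colouring c by the block colouring of the
  -- composition `mu`.
  have e : a * b = a * ((u⁻¹ : (Tau r)ˣ) : Tau r) * ((u : Tau r) * b) := by simp [mul_assoc]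
  rw [e, ← f_mul_f_eq_f (v := mu)]
  · exact f_mem_idealBelow k hlt _ _
  · intro ρ hρ
    have := h (u⁻¹ * ρ * u) ((hK _).2 (by simpa [mul_assoc] using hρ))
    rw [← e, ← this]
    simp [mul_assoc]
  · rw [← e, nRel_mul_unit_inv hK, nRel_unit_mul hK, ← hn,
      Nat.card_congr (conjEquiv u hK)]

theorem mul_oneAt_apply (x : BR k r n) (mu l v : Comp r n) (D : DC (young l) (young v)) :
    (x * oneAt k mu) l v D = if v = mu then x l v D else 0 := by
  rw [RGS.mul_apply]
  split_ifs with h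
  · subst h
    rw [Finset.sum_eq_single v, Finset.sum_comm, Finset.sum_eq_single (DC.mk _ _ 1)]
    · simp [RGS.idem, RGS.f_self, structConst_one_right]
    · intro E _ hE
      simp [RGS.idem, RGS.f_self, hE]
    · simp
    · intro w _ hw
      simp [RGS.idem, RGS.f_of_ne_left hw]
    · simp
  · refine Finset.sum_eq_zero fun w _ => Finset.sum_eq_zero fun E₁ _ =>
      Finset.sum_eq_zero fun E₂ _ => ?_
    by_cases hw : w = mu
    · subst hw
      simp [RGS.idem, RGS.f_of_ne_right h]
    · simp [RGS.idem, RGS.f_of_ne_left hw]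

theorem mul_eBelow_apply (x : BR k r n) (lam l v : Comp r n) (D : DC (young l) (young v)) :
    (x * eBelow k lam) l v D = if Comp.Lt v lam then x l v D else 0 := by
  rw [eBelow, Finset.mul_sum, RGS.sum_apply]
  simp [mul_oneAt_apply]

/-- If the coefficients of `f(λ, D, λ)` in all products through smaller compositions vanish, then
so does the coordinate at `f(λ, D, λ)` of every element of the ideal. -/
theorem idealBelow_apply_eq_zero {lam : Comp r n} {D : DC (young lam) (young lam)}
    (h : ∀ mu, Comp.Lt mu lam → ∀ (D₁ : DC (young lam) (young mu)) (D₂ : DC (young mu) (young lam)),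
      (structConst D₁ D₂ D : k) = 0) {x : BR k r n} (hx : x ∈ idealBelow k lam) :
    x lam lam D = 0 := by
  rw [idealBelow, TwoSidedIdeal.mem_span_iff_mem_addSubgroup_closure] at hx
  induction hx using AddSubgroup.closure_induction with
  | mem x hx =>
    -- A generator of the additive group is y e_λ z, and e_λ restricts the sum over the middle index
    -- to compositions below λ.
    obtain ⟨_, ⟨y, -, _, rfl, rfl⟩, z, -, rfl⟩ := hx
    simp only [RGS.mul_apply (_ * _), mul_eBelow_apply]
    refine Finset.sum_eq_zero fun mu _ => Finset.sum_eq_zero fun D₁ _ =>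
      Finset.sum_eq_zero fun D₂ _ => ?_
    split_ifs with hmu
    · rw [h mu hmu, zero_mul]
    · simp
  | zero => rfl
  | add x y _ _ hx hy => rw [RGS.add_apply, hx, hy, add_zero]
  | neg x _ hx =>
    change - x lam lam D = 0
    rw [hx, neg_zero]

theorem mem_idealAt {lam : Comp r n} {x : BRAt k lam} :
    x ∈ idealAt k lam ↔ x.1 ∈ idealBelow k lam := TwoSidedIdeal.mem_comap _

end Ideal


/-! ### Divisibility of structure constants -/

section Divisibility

/-- The size p^i of the G-orbit divides the size of the S-orbit times the index of S, and it is
coprime to that index. -/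
theorem orbit_subgroup_eq_of_not_dvd_index {G X : Type*} [Group G] [Finite G] [MulAction G X]
    [Finite X] (S : Subgroup G) (x : X) {p i : ℕ} (hp : p.Prime)
    (hx : (MulAction.orbit G x).ncard = p ^ i) (hS : ¬ p ∣ S.index) :
    MulAction.orbit S x = MulAction.orbit G x := by
  have hsub : MulAction.orbit S x ⊆ MulAction.orbit G x := by
    rintro _ ⟨s, rfl⟩
    exact ⟨s.1, rfl⟩
  refine Set.eq_of_subset_of_ncard_le hsub ?_ (Set.toFinite _)
  have h1 : (MulAction.orbit S x).ncard = (MulAction.stabilizer G x ⊓ S).relIndex S := by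
    rw [← MulAction.index_stabilizer, Subgroup.inf_relIndex_right, Subgroup.relIndex]
    congr 1
  have h2 : (MulAction.orbit G x).ncard ∣ (MulAction.orbit S x).ncard * S.index := by
    rw [h1, Subgroup.relIndex_mul_index inf_le_right, ← MulAction.index_stabilizer]
    exact Subgroup.index_dvd_of_le inf_le_left
  rw [hx] at h2 ⊢
  refine Nat.le_of_dvd ?_ (Nat.Coprime.dvd_of_dvd_mul_right
    (Nat.Coprime.pow_left i ((Nat.Prime.coprime_iff_not_dvd hp).2 hS)) h2)
  rw [Set.ncard_pos]
  exact ⟨x, MulAction.mem_orbit_self x⟩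

/-- The set being counted is a union of left cosets of `stabR K b L`: if κ b = b π, replacing ρ by ρ
κ multiplies a ρ b on the right by π ∈ L. -/
theorem nRel_dvd_NRel {M : Type*} [Monoid M] [Finite M] {H K L : Subgroup Mˣ} (a b : M)
    (D : DC H L) : nRel K b L ∣ NRel (K := K) a b D := by
  have : Fintype K := Fintype.ofFinite _
  have h := N_eq_sum (H := H) (K := K) (L := L) a b D
  rw [DC.N_mk] at h
  rw [h]
  have := dvd_sum_of_invariant (stabR K b L)
    (fun ρ : K => if DC.mk H L (a * ((ρ : Mˣ) : M) * b) = D then 1 else 0) 1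
    (fun _ => one_dvd _) ?_
  · rwa [mul_one] at this
  · rintro ρ κ ⟨π, hπ, e⟩
    have : DC.mk H L (a * (((ρ * κ : K) : Mˣ) : M) * b) = DC.mk H L (a * ((ρ : Mˣ) : M) * b) := by
      symm
      rw [DC.mk_eq_iff]
      refine ⟨1, H.one_mem, π, hπ, ?_⟩
      simp only [Subgroup.coe_mul, Units.val_mul, Units.val_one, one_mul, mul_assoc]
      rw [e]
    rw [this]

/-- If `n_R(D)` is as large as possible, the structure constants at `D` are multiples of the
index of the stabilizer of the left factor. -/
theorem structConst_eq_index_mul {M : Type*} [Monoid M] [Finite M] {H K L : Subgroup Mˣ} (a b g : M)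
    (hg : nRel H g L = Nat.card H) :
    structConst (DC.mk H K a) (DC.mk K L b) (DC.mk H L g)
      = (stabR H a K).index * (NRel (K := K) a b (DC.mk H L g) / nRel K b L) := by
  obtain ⟨d, hd⟩ := nRel_dvd_NRel (K := K) a b (DC.mk H L g)
  apply Nat.eq_of_mul_eq_mul_right (Nat.mul_pos (DC.mk H K a).nR_pos (DC.mk K L b).nR_pos)
  rw [structConst_mul, DC.N_mk, DC.nR_mk, DC.nR_mk, DC.nR_mk, hg, hd,
    Nat.mul_div_cancel_left _ (nRel_pos K b L), ← Subgroup.index_mul_card (stabR H a K),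
    show nRel H a K = Nat.card (stabR H a K) from rfl]
  ring

variable {r n : ℕ}

theorem ncard_orbit_young (lam : Comp r n) (x : Fin r) :
    (MulAction.orbit (young lam) x).ncard = lam.1 (blk lam x) := by
  rw [← card_blk, ← Set.ncard_coe_finset]
  congr 1
  ext y
  simp only [Finset.coe_filter, Finset.mem_univ, true_and, Set.mem_ofPred_eq]
  constructor
  · rintro ⟨σ, rfl⟩
    have := (young_eq lam).le σ.2
    exact this x
  · intro h
    obtain ⟨σ, hσ, rfl⟩ := exists_mem_colGrp_apply h.symm
    exact ⟨⟨σ, by rwa [young_eq]⟩, rfl⟩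

theorem mem_orbit_young {lam : Comp r n} {x y : Fin r} (h : blk lam x = blk lam y) :
    y ∈ MulAction.orbit (young lam) x := by
  obtain ⟨σ, hσ, rfl⟩ := exists_mem_colGrp_apply h
  exact ⟨⟨σ, by rwa [young_eq]⟩, rfl⟩

/-- Blocks are orbits of p-power size, so the stabilizer of a is still transitive on each of them,
and its elements preserve the counts. -/
theorem rowConst_of_not_dvd_index {lam mu : Comp r n} {p : ℕ} (hp : p.Prime)
    (hlam : IsPPartition p lam) {a : Tau r} (h : ¬ p ∣ (stabR (young lam) a (young mu)).index) :
    RowConst (blk lam) a (blk mu) := by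
  intro x x' t hx
  have hpos : lam.1 (blk lam x) ≠ 0 := by
    rw [← card_blk]
    exact (Finset.card_pos.2 ⟨x, by simp⟩).ne'
  obtain ⟨i, hi⟩ := (hlam.2 (blk lam x)).resolve_left hpos
  have horb := orbit_subgroup_eq_of_not_dvd_index (stabR (young lam) a (young mu)) x hp
    ((ncard_orbit_young lam x).trans hi) h
  have hmem := mem_orbit_young hx
  rw [← horb] at hmem
  obtain ⟨σ, rfl⟩ := hmem
  have hσ := mem_stabR.1 σ.2
  simp only [young_eq mu] at hσ
  exact ((exists_unit_mul_eq_mul_iff _ _ _).1 hσ x t).symm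

end Divisibility

/-! ### Weights of coarsenings -/

section Weights

/-- A numerical form of the fact that the weight increases under coarsening. -/
theorem sum_pow_le_sum_pow {J : Type*} [Fintype J] [DecidableEq J] {N q : ℕ} (hN : 1 ≤ N)
    (hq : 0 < q) (l : J → ℕ) (m : J → ℕ) (w : J → J → ℕ) (hl : ∀ j, l j = 0 ∨ q ≤ l j)
    (hsum : ∑ j, l j = ∑ t, m t)
    (hm : ∀ t, m t = ∑ j, w j t) (hw : ∀ j t, q ∣ w j t) (hlq : ∀ j, q ∣ l j)
    (hbig : ∀ j, q < l j → ∃ t, l j ≤ w j t) :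
    ∑ j, ((N : ℤ) ^ l j - 1) ≤ ∑ t, ((N : ℤ) ^ m t - 1) := by
  -- F is superadditive with F 0 = 0; without the -1 superadditivity would fail at 0.
  let F : ℕ → ℤ := fun x => (N : ℤ) ^ x - 1
  have hN' : (1 : ℤ) ≤ N := by exact_mod_cast hN
  have hF0 : ∀ x, 0 ≤ F x := fun x => sub_nonneg.2 (one_le_pow₀ hN')
  have hadd : ∀ x y, F x + F y ≤ F (x + y) := by
    intro x y
    have h := mul_nonneg (hF0 x) (hF0 y)
    simp only [F, pow_add] at *
    linarith
  have hzero : F 0 = 0 := by simp [F]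
  have hsumF : ∀ s : Finset J, ∑ j ∈ s, F (l j) ≤ F (∑ j ∈ s, l j) := by
    intro s
    induction s using Finset.induction_on with
    | empty => simp [hzero]
    | insert a s ha ih =>
      rw [Finset.sum_insert ha, Finset.sum_insert ha]
      linarith [hadd (l a) (∑ j ∈ s, l j)]
  have hmul : ∀ d : ℕ, (d : ℤ) * F q ≤ F (q * d) := by
    intro d
    induction d with
    | zero => simp [hzero]
    | succ d ih =>
      have := hadd (q * d) q
      rw [Nat.mul_succ]
      push_cast
      linarith
  -- This is (x / q) F(q) ≤ F(x), multiplied by q to avoid division.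
  have hdvd : ∀ x : ℕ, q ∣ x → (x : ℤ) * F q ≤ q * F x := by
    rintro _ ⟨d, rfl⟩
    have := mul_le_mul_of_nonneg_left (hmul d) (Int.natCast_nonneg q)
    push_cast
    linarith
  have hex : ∀ j, ∃ t, q < l j → l j ≤ w j t := by
    intro j
    by_cases hj : q < l j
    · obtain ⟨t, ht⟩ := hbig j hj
      exact ⟨t, fun _ => ht⟩
    -- A dummy value: g is used only on B.
    · exact ⟨j, fun h => absurd h hj⟩
  choose g hg using hex
  let B : Finset J := Finset.univ.filter fun j => q < l j
  -- The large parts are distributed among the m t by g, and u t is the total of those placed in m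
  -- t.
  let u : J → ℕ := fun t => ∑ j ∈ B with g j = t, l j
  have hu : ∀ t, u t ≤ m t := by
    intro t
    rw [hm]
    refine (Finset.sum_le_sum (g := fun j => w j t) fun j hj => ?_).trans
      (Finset.sum_le_sum_of_subset (Finset.subset_univ _))
    simp only [B, Finset.mem_filter, Finset.mem_univ, true_and] at hj
    exact hj.2 ▸ hg j hj.1
  -- The room m t - u t left beside the large parts is a multiple of q, so it counts for at least as
  -- much as being filled with parts of size q.
  have hkey : ∀ t, (q : ℤ) * ∑ j ∈ B with g j = t, F (l j) + ((m t : ℤ) - u t) * F q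
      ≤ q * F (m t) := by
    intro t
    have h1 : q ∣ m t - u t := by
      refine Nat.dvd_sub ?_ ?_
      · rw [hm]
        exact Finset.dvd_sum fun j _ => hw j t
      · exact Finset.dvd_sum fun j _ => hlq j
    have h2 := hdvd _ h1
    have h3 := hadd (u t) (m t - u t)
    rw [Nat.add_sub_cancel' (hu t)] at h3
    rw [Nat.cast_sub (hu t)] at h2
    have h4 := hsumF (B.filter fun j => g j = t)
    have h5 := mul_le_mul_of_nonneg_left (h3.trans' (add_le_add_left h4 _)) (Int.natCast_nonneg q)
    linarith
  have hsmall : ∀ j ∉ B, (l j : ℤ) * F q = q * F (l j) := by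
    intro j hj
    simp only [B, Finset.mem_filter, Finset.mem_univ, true_and, not_lt] at hj
    rcases hl j with h | h
    · rw [h, hzero]; simp
    · rw [le_antisymm hj h]
  have htot := Finset.sum_le_sum fun t (_ : t ∈ Finset.univ) => hkey t
  rw [Finset.sum_add_distrib, ← Finset.mul_sum, ← Finset.sum_mul, ← Finset.mul_sum,
    Finset.sum_fiberwise, Finset.sum_sub_distrib (fun t => (m t : ℤ)) fun t => (u t : ℤ)] at htot
  have hus : ∑ t, (u t : ℤ) = ∑ j ∈ B, (l j : ℤ) := by
    simp only [u, Nat.cast_sum]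
    rw [Finset.sum_fiberwise]
  have hms : ∑ t, (m t : ℤ) = ∑ j ∈ B, (l j : ℤ) + ∑ j ∈ Bᶜ, (l j : ℤ) := by
    rw [Finset.sum_add_sum_compl]
    exact_mod_cast hsum.symm
  -- The rooms left over add up to the total of the small parts, each of which is 0 or exactly q;
  -- for those the bound by multiples of F(q) is an equality.
  have hfin : (q : ℤ) * ∑ j, F (l j) ≤ q * ∑ t, F (m t) := by
    refine le_trans (le_of_eq ?_) htot
    rw [hus, hms, add_sub_cancel_left, Finset.sum_mul,
      Finset.sum_congr rfl fun j hj => hsmall j (Finset.mem_compl.1 hj), ← Finset.mul_sum,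
      ← mul_add, Finset.sum_add_sum_compl]
  exact le_of_mul_le_mul_left hfin (by exact_mod_cast hq)

variable {r n : ℕ}

/-- Over block j there are lam_j times a constant count points of colour t. This number is a
multiple of q, and for a block longer than q, which meets the image, it is at least lam_j for some
t. So each long block fits inside a single colour class, and `sum_pow_le_sum_pow` applies. -/
theorem weight_le_weight_of_rowConst {lam : Comp r n} {c : Fin r → Fin n} {q : ℕ} (hq : 0 < q)
    (hlq : ∀ j, q ∣ lam.1 j) {a : Tau r} (ha : RowConst (blk lam) a c)
    (him : ∀ x, q < lam.1 (blk lam x) → ∃ y, a y = x) :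
    weight (blk lam) ≤ weight c := by
  let m : Fin n → ℕ := fun t => (Finset.univ.filter fun x => c x = t).card
  let w : Fin n → Fin n → ℕ := fun j t => ∑ x with blk lam x = j, cnt a c x t
  have hmt : ∀ t, m t = ∑ x, cnt a c x t := by
    intro t
    rw [show m t = _ from Finset.card_eq_sum_card_fiberwise (f := a) (t := Finset.univ)
      (fun x _ => Finset.mem_coe.2 (Finset.mem_univ _))]
    refine Finset.sum_congr rfl fun x _ => ?_
    rw [cnt, Finset.filter_filter]
    congr 1
    ext y
    simp [and_comm]
  have hwx : ∀ x t, w (blk lam x) t = lam.1 (blk lam x) * cnt a c x t := by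
    intro x t
    rw [← card_blk lam (blk lam x), ← smul_eq_mul, ← Finset.sum_const]
    exact Finset.sum_congr rfl fun y hy => ha _ _ _ (Finset.mem_filter.1 hy).2
  have hex : ∀ j, lam.1 j ≠ 0 → ∃ x, blk lam x = j := by
    intro j hj
    rw [← card_blk, ← Nat.pos_iff_ne_zero, Finset.card_pos] at hj
    obtain ⟨x, hx⟩ := hj
    exact ⟨x, (Finset.mem_filter.1 hx).2⟩
  have key := sum_pow_le_sum_pow (N := n + 1) (q := q) (by omega) hq lam.1 m w ?_ ?_ ?_ ?_ hlq ?_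
  -- Both sums have n terms, so the subtracted ones cancel.
  · rw [Finset.sum_sub_distrib, Finset.sum_sub_distrib] at key
    have key' := (sub_le_sub_iff_right _).1 key
    rw [weight_blk, weight]
    exact_mod_cast key'
  · intro j
    rcases Nat.eq_zero_or_pos (lam.1 j) with h | h
    · exact .inl h
    · exact .inr (Nat.le_of_dvd h (hlq j))
  · rw [lam.2, ← Finset.card_eq_sum_card_fiberwise (fun x _ => Finset.mem_univ (c x))]
    simp
  · intro t
    rw [hmt]
    exact (Finset.sum_fiberwise _ _ _).symm
  · intro j t
    by_cases hj : lam.1 j = 0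
    · simp only [w]
      rw [← card_blk, Finset.card_eq_zero] at hj
      rw [hj]
      simp
    · obtain ⟨x, rfl⟩ := hex j hj
      rw [hwx]
      exact Dvd.dvd.mul_right (hlq _) _
  · intro j hj
    obtain ⟨x, rfl⟩ := hex j (by omega)
    obtain ⟨y, hy⟩ := him x hj
    refine ⟨c y, ?_⟩
    rw [hwx]
    exact Nat.le_mul_of_pos_right _ (cnt_pos.2 ⟨y, hy, rfl⟩)

/-- If p did not divide the constant, the left factor would be row-constant and its image would
contain all blocks longer than q. Then λ could not outweigh μ. -/
theorem prime_dvd_structConst {lam mu : Comp r n} {p : ℕ} (hp : p.Prime)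
    (hlam : IsPPartition p lam) {q : ℕ} (hq : 0 < q) (hlq : ∀ j, q ∣ lam.1 j) {a : Tau r}
    (ha : RowConst (blk lam) a (blk lam)) (him : ∀ x, q < lam.1 (blk lam x) → ∃ y, a y = x)
    (hmu : Comp.Lt mu lam) (D₁ : DC (young lam) (young mu)) (D₂ : DC (young mu) (young lam)) :
    p ∣ structConst D₁ D₂ (DC.mk (young lam) (young lam) a) := by
  induction D₁ using DC.ind with | h b => ?_
  induction D₂ using DC.ind with | h d => ?_
  have hn : nRel (young lam) a (young lam) = Nat.card (young lam) := by
    have := ha.nRel_eq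
    rwa [← young_eq] at this
  rw [structConst_eq_index_mul _ _ _ hn]
  by_contra hdvd
  have hidx : ¬ p ∣ (stabR (young lam) b (young mu)).index := fun h => hdvd (Dvd.dvd.mul_right h _)
  have hN : NRel (K := young mu) b d (DC.mk (young lam) (young lam) a) ≠ 0 := by
    intro h
    rw [h] at hdvd
    simp at hdvd
  obtain ⟨⟨ρ, hρ⟩⟩ := (Nat.card_ne_zero.1 hN).1
  -- Here b ρ d = σ a π, so the image of b contains σ applied to the image of a; σ preserves blocks,
  -- so long blocks remain covered.
  obtain ⟨σ, hσ, π, -, e⟩ := DC.mk_eq_iff.1 hρ.symm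
  refine absurd (weight_lt_of_lt hmu) (not_lt.2 (weight_le_weight_of_rowConst hq hlq
    (rowConst_of_not_dvd_index hp hlam hidx) fun x hx => ?_))
  have hσ' : σ⁻¹ ∈ colGrp (blk lam) := by
    rw [← young_eq]
    exact inv_mem hσ
  obtain ⟨y, hy⟩ := him (((σ⁻¹ : (Tau r)ˣ) : Tau r) x) (by rwa [hσ' x])
  refine ⟨((ρ : (Tau r)ˣ) : Tau r) (d (((π⁻¹ : (Tau r)ˣ) : Tau r) y)), ?_⟩
  have := congrFun e (((π⁻¹ : (Tau r)ˣ) : Tau r) y)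
  simp only [tau_mul_apply, unit_apply_inv_self] at this
  rw [this, hy, unit_apply_inv_self]

end Weights


/-! ### Basis elements in the ideal -/

section Splitting

variable {r n : ℕ}

/-- This is where r ≤ n enters: a composition with a part at least 2 leaves an index free for one
half of a split block. -/
theorem exists_part_eq_zero (hrn : r ≤ n) {lam : Comp r n} {i : Fin n} (hi : 2 ≤ lam.1 i) :
    ∃ z, lam.1 z = 0 := by
  by_contra! hz
  have h1 : ∑ j : Fin n, 1 < ∑ j, lam.1 j :=
    Finset.sum_lt_sum (fun j _ => Nat.one_le_iff_ne_zero.2 (hz j)) ⟨i, Finset.mem_univ _, hi⟩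
  rw [lam.2] at h1
  simp at h1
  omega

/-- A block can be split in two parts; this decreases the weight. -/
theorem exists_split (hrn : r ≤ n) (lam : Comp r n) (i : Fin n) (P : Fin r → Prop) {y y' : Fin r}
    (hy : blk lam y = i) (hPy : P y) (hy' : blk lam y' = i) (hPy' : ¬ P y') :
    ∃ c : Fin r → Fin n, weight c < weight (blk lam) ∧
      ∀ x x', c x = c x' ↔ blk lam x = blk lam x' ∧ (blk lam x = i → (P x ↔ P x')) := by
  let u := (Finset.univ.filter fun x => blk lam x = i ∧ P x).card
  let v := (Finset.univ.filter fun x => blk lam x = i ∧ ¬ P x).card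
  have huv : lam.1 i = u + v := by
    rw [← card_blk, ← Finset.card_filter_add_card_filter_not (p := P), Finset.filter_filter,
      Finset.filter_filter]
  have hu : 0 < u := Finset.card_pos.2 ⟨y, by simp [hy, hPy]⟩
  have hv : 0 < v := Finset.card_pos.2 ⟨y', by simp [hy', hPy']⟩
  obtain ⟨z, hz⟩ := exists_part_eq_zero hrn (lam := lam) (i := i) (by omega)
  have hzi : z ≠ i := by
    rintro rfl
    omega
  have hbz : ∀ x, blk lam x ≠ z := by
    intro x hx
    rw [← card_blk, Finset.card_eq_zero, Finset.filter_eq_empty_iff] at hz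
    exact hz (Finset.mem_univ x) hx
  -- The points of block i outside P move to the empty index z.
  let c : Fin r → Fin n := fun x => if blk lam x = i ∧ ¬ P x then z else blk lam x
  refine ⟨c, ?_, ?_⟩
  · have hci : (Finset.univ.filter fun x => c x = i).card = u := by
      refine congrArg Finset.card (Finset.filter_congr fun x _ => ?_)
      simp only [c]
      split_ifs with h
      · simp [hzi, h]
      · constructor
        · exact fun hx => ⟨hx, by_contra fun hP => h ⟨hx, hP⟩⟩
        · exact fun hx => hx.1
    have hcz : (Finset.univ.filter fun x => c x = z).card = v := by
      refine congrArg Finset.card (Finset.filter_congr fun x _ => ?_)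
      simp only [c]
      split_ifs with h
      · simp [h]
      · simp only [hbz x, false_iff]
        exact h
    have hct : ∀ t, t ≠ i → t ≠ z →
        (Finset.univ.filter fun x => c x = t).card = lam.1 t := by
      intro t hti htz
      rw [← card_blk]
      refine congrArg Finset.card (Finset.filter_congr fun x _ => ?_)
      simp only [c]
      split_ifs with h
      · simp [htz.symm, h.1, hti.symm]
      · rfl
    rw [weight_blk, weight]
    have hmem : i ∈ Finset.univ.erase z := by simp [hzi.symm]
    rw [← Finset.add_sum_erase _ _ (Finset.mem_univ z), ← Finset.add_sum_erase _ _ hmem,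
      ← Finset.add_sum_erase _ (fun j => (n + 1) ^ lam.1 j) (Finset.mem_univ z),
      ← Finset.add_sum_erase _ (fun j => (n + 1) ^ lam.1 j) hmem, hci, hcz, hz, huv,
      Finset.sum_congr rfl (g := fun j => (n + 1) ^ lam.1 j) fun t ht => by
        rw [hct t (Finset.ne_of_mem_erase ht)
          (Finset.ne_of_mem_erase (Finset.mem_of_mem_erase ht))], ← add_assoc, ← add_assoc]
    refine Nat.add_lt_add_right ?_ _
    have hn : 0 < n := Fin.pos i
    have h1 : 1 < (n + 1) ^ u := Nat.one_lt_pow hu.ne' (by omega)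
    have h2 : 1 < (n + 1) ^ v := Nat.one_lt_pow hv.ne' (by omega)
    -- The remaining inequality is (N^u - 1)(N^v - 1) > 0 with N = n + 1.
    rw [pow_add, pow_zero]
    nlinarith
  · intro x x'
    simp only [c]
    have hx := hbz x
    have hx' := hbz x'
    split_ifs with h h' h'
    · simp [h, h']
    · simp only [hx'.symm, false_iff, not_and, not_forall]
      intro e
      refine ⟨h.1, fun hP => h' ⟨e ▸ h.1, fun hp => h.2 (hP.2 hp)⟩⟩
    · simp only [hx, false_iff, not_and, not_forall]
      intro e
      refine ⟨e ▸ h'.1, fun hP => h ⟨e ▸ h'.1, fun hp => h'.2 (hP.1 hp)⟩⟩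
    · constructor
      · intro e
        refine ⟨e, fun hi => ?_⟩
        have h1 : P x := by_contra fun hP => h ⟨hi, hP⟩
        have h2 : P x' := by_contra fun hP => h' ⟨e ▸ hi, hP⟩
        simp [h1, h2]
      · exact fun e => e.1

theorem nRel_eq_nRel {M : Type*} [Monoid M] {H H' K K' : Subgroup Mˣ} {a a' : M}
    (h : ∀ σ : Mˣ, (σ ∈ H ∧ ∃ π ∈ K, (σ : M) * a = a * (π : M)) ↔
      (σ ∈ H' ∧ ∃ π ∈ K', (σ : M) * a' = a' * (π : M))) : nRel H a K = nRel H' a' K' :=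
  Nat.card_congr
    { toFun := fun σ => ⟨⟨σ.1.1, ((h _).1 ⟨σ.1.2, σ.2⟩).1⟩, ((h _).1 ⟨σ.1.2, σ.2⟩).2⟩
      invFun := fun σ => ⟨⟨σ.1.1, ((h _).2 ⟨σ.1.2, σ.2⟩).1⟩, ((h _).2 ⟨σ.1.2, σ.2⟩).2⟩
      left_inv := fun _ => rfl
      right_inv := fun _ => rfl }

theorem RowConst.nRel_young {lam : Comp r n} {a : Tau r} (h : RowConst (blk lam) a (blk lam)) :
    nRel (young lam) a (young lam) = Nat.card (young lam) := by
  have := h.nRel_eq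
  rwa [← young_eq] at this

variable (k : Type*) [CommRing k]

/-- The block is split by the value of a count that is not constant on it. Elements stabilizing a
preserve counts, hence the splitting c, so n_R(λ,a,λ) = n_R(c,a,λ) and f(λ,1,c) f(c,a,λ) = f(λ,a,λ).
-/
theorem f_mem_idealBelow_of_not_rowConst (hrn : r ≤ n) {lam : Comp r n} {a : Tau r}
    (h : ¬ RowConst (blk lam) a (blk lam)) :
    RGS.f k lam lam (DC.mk _ _ a) ∈ idealBelow k lam := by
  simp only [RowConst, not_forall] at h
  obtain ⟨x, x', t, hx, hne⟩ := h
  obtain ⟨c, hc, hcc⟩ := exists_split hrn lam (blk lam x)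
    (fun y => cnt a (blk lam) y t = cnt a (blk lam) x t) rfl rfl hx.symm (fun e => hne e.symm)
  have hle : colGrp c ≤ young lam := by
    rw [young_eq]
    exact fun σ hσ y => ((hcc _ _).1 (hσ y)).1
  have hmul := f_mem_idealBelow_of_factor k hc (a := 1) (b := a) ?_ ?_
  · rwa [one_mul] at hmul
  · intro ρ hρ
    symm
    rw [DC.mk_eq_iff]
    exact ⟨ρ, hle hρ, 1, one_mem _, by simp⟩
  · have h1 : nRel (young lam) 1 (colGrp c) = Nat.card (colGrp c) := by
      rw [← nRel_one (M := Tau r) (colGrp c)]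
      refine nRel_eq_nRel fun σ => ⟨?_, fun hσ => ⟨hle hσ.1, hσ.2⟩⟩
      rintro ⟨-, π, hπ, e⟩
      rw [mul_one, one_mul, Units.val_inj] at e
      exact ⟨e ▸ hπ, π, hπ, by rw [e]; simp⟩
    rw [h1, one_mul, mul_comm]
    congr 1
    refine nRel_eq_nRel fun σ => ⟨?_, fun hσ => ⟨hle hσ.1, hσ.2⟩⟩
    rw [young_eq]
    rintro ⟨hσ, h2⟩
    refine ⟨fun y => (hcc _ _).2 ⟨hσ y, fun _ => ?_⟩, h2⟩
    rw [(exists_unit_mul_eq_mul_iff _ _ _).1 h2 y t]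

/-- If `a` has constant fibres on rows, and does not map the block of `y` injectively to a row,
then that block can be split keeping the fibres constant on rows. -/
theorem exists_split_rowConst (hrn : r ≤ n) {lam : Comp r n} {a : Tau r}
    (ha : RowConst (blk lam) a (blk lam)) {y y' : Fin r} (hyy : blk lam y = blk lam y')
    (hne : y ≠ y') (h : a y = a y' ∨ blk lam (a y) ≠ blk lam (a y')) :
    ∃ c : Fin r → Fin n, weight c < weight (blk lam) ∧ RowConst (blk lam) a c ∧
      ∀ x x', c x = c x' → blk lam x = blk lam x' := by
  let Q : Fin r → Fin r → Prop := fun x z => a z = x ∧ blk lam z = blk lam y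
  -- A chosen preimage of x in the block of y. The default value is harmless: P below only matters
  -- for z in the block of y, and there a z has such a preimage.
  let s : Fin r → Fin r := fun x => if h : ∃ z, Q x z then h.choose else y
  have hs : ∀ x, (∃ z, Q x z) → Q x (s x) := by
    intro x hx
    simp only [s, dif_pos hx]
    exact hx.choose_spec
  -- P picks one point over each value of a that lies in the block of a y.
  let P : Fin r → Prop := fun z => z = s (a z) ∧ blk lam (a z) = blk lam (a y)
  have hsy := hs (a y) ⟨y, rfl, rfl⟩
  have hPs : P (s (a y)) := ⟨by rw [hsy.1], by rw [hsy.1]⟩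
  -- If P held on the whole block, a would map it injectively into one block.
  obtain ⟨w, hw, hPw⟩ : ∃ w, blk lam w = blk lam y ∧ ¬ P w := by
    by_contra! hc
    have h1 := hc y rfl
    have h2 := hc y' hyy.symm
    rcases h with h | h
    · exact hne (by rw [h1.1, h2.1, h])
    · exact h h2.2.symm
  obtain ⟨c, hc, hcc⟩ := exists_split hrn lam (blk lam y) P hsy.2 hPs hw hPw
  refine ⟨c, hc, ?_, fun x x' hx => ((hcc x x').1 hx).1⟩
  -- The chosen points number 0 or 1 over x, depending only on the block of x. The unchosen points
  -- of the block are then row-constant by subtraction.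
  have hA : ∀ x, (Finset.univ.filter fun z => (a z = x ∧ blk lam z = blk lam y) ∧ P z).card
      = if blk lam x = blk lam (a y) ∧ 0 < cnt a (blk lam) x (blk lam y) then 1 else 0 := by
    intro x
    split_ifs with hx
    · have hQ := hs x (cnt_pos.1 hx.2)
      rw [Finset.card_eq_one]
      refine ⟨s x, ?_⟩
      ext z
      simp only [Finset.mem_filter, Finset.mem_univ, true_and, Finset.mem_singleton]
      constructor
      · rintro ⟨⟨rfl, -⟩, hP⟩
        exact hP.1
      · rintro rfl
        refine ⟨hQ, ?_, ?_⟩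
        · rw [hQ.1]
        · rw [hQ.1, hx.1]
    · rw [Finset.card_eq_zero, Finset.filter_eq_empty_iff]
      rintro z - ⟨⟨rfl, hz⟩, hP⟩
      exact hx ⟨hP.2, cnt_pos.2 ⟨z, rfl, hz⟩⟩
  intro x x' t hx
  by_cases ht : ∃ y₀, c y₀ = t
  · obtain ⟨y₀, rfl⟩ := ht
    by_cases hy0 : blk lam y₀ = blk lam y
    · have hAx : (Finset.univ.filter fun z => (a z = x ∧ blk lam z = blk lam y) ∧ P z).card
          = (Finset.univ.filter fun z => (a z = x' ∧ blk lam z = blk lam y) ∧ P z).card := by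
        rw [hA, hA, hx, ha x x' _ hx]
      by_cases hP0 : P y₀
      · have e : ∀ x, cnt a c x (c y₀) = (Finset.univ.filter fun z =>
            (a z = x ∧ blk lam z = blk lam y) ∧ P z).card := by
          intro x
          unfold cnt
          congr 1
          ext z
          simp only [Finset.mem_filter, Finset.mem_univ, true_and]
          rw [hcc, hy0, and_assoc]
          refine and_congr_right fun _ => and_congr_right fun hz => ?_
          simp [hz, hP0]
        rw [e, e, hAx]
      · have e : ∀ x, cnt a c x (c y₀) = (Finset.univ.filter fun z =>
            (a z = x ∧ blk lam z = blk lam y) ∧ ¬ P z).card := by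
          intro x
          unfold cnt
          congr 1
          ext z
          simp only [Finset.mem_filter, Finset.mem_univ, true_and]
          rw [hcc, hy0, and_assoc]
          refine and_congr_right fun _ => and_congr_right fun hz => ?_
          simp [hz, hP0]
        have e' : ∀ x, cnt a (blk lam) x (blk lam y)
            = (Finset.univ.filter fun z => (a z = x ∧ blk lam z = blk lam y) ∧ P z).card
              + cnt a c x (c y₀) := by
          intro x
          rw [e, cnt, ← Finset.card_filter_add_card_filter_not (p := P), Finset.filter_filter,
            Finset.filter_filter]
          congr!
        have h1 := e' x
        have h2 := e' x'
        rw [ha x x' _ hx] at h1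
        omega
    · have e : ∀ x, cnt a c x (c y₀) = cnt a (blk lam) x (blk lam y₀) := by
        intro x
        unfold cnt
        congr 1
        ext z
        simp only [Finset.mem_filter, Finset.mem_univ, true_and]
        rw [hcc]
        refine and_congr_right fun _ => ⟨fun hz => hz.1, fun hz => ⟨hz, fun hz' => ?_⟩⟩
        exact absurd (hz ▸ hz') hy0
      rw [e, e]
      exact ha _ _ _ hx
  · have e : ∀ x, cnt a c x t = 0 := by
      intro x
      rw [← Nat.le_zero, ← not_lt, cnt_pos]
      rintro ⟨z, -, hz⟩
      exact ht ⟨z, hz⟩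
    rw [e, e]

/-- After the splitting c of the source of a, each of a, b and a b has full stabilizer, so f(λ,a,c)
f(c,b,λ) is the single basis element of a b. Both b = 1 and b = φ_λ(A) with a a fold are needed
later. -/
theorem f_mul_mem_idealBelow (hrn : r ≤ n) {lam : Comp r n} {a b : Tau r}
    (ha : RowConst (blk lam) a (blk lam)) (hb : RowConst (blk lam) b (blk lam)) {y y' : Fin r}
    (hyy : blk lam y = blk lam y') (hne : y ≠ y')
    (h : a y = a y' ∨ blk lam (a y) ≠ blk lam (a y')) :
    RGS.f k lam lam (DC.mk _ _ (a * b)) ∈ idealBelow k lam := by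
  obtain ⟨c, hc, hac, hcc⟩ := exists_split_rowConst hrn ha hyy hne h
  have hle : colGrp c ≤ colGrp (blk lam) := fun σ hσ y => hcc _ _ (hσ y)
  refine f_mem_idealBelow_of_factor k hc ?_ ?_
  · intro ρ hρ
    obtain ⟨π, hπ, e⟩ := rowConst_iff.1 hb ρ (hle hρ)
    symm
    rw [DC.mk_eq_iff]
    refine ⟨1, one_mem _, π, by rwa [young_eq], ?_⟩
    rw [mul_assoc, e]
    simp [mul_assoc]
  · have hbc : RowConst c b (blk lam) := fun x x' t hx => hb x x' t (hcc x x' hx)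
    have h1 := hac.nRel_eq
    have h2 := hbc.nRel_eq
    rw [← young_eq] at h1 h2
    rw [(ha.mul hb).nRel_young, h1, h2]

/-- `a` maps every block injectively into a block. -/
def RowInj (lam : Comp r n) (a : Tau r) : Prop :=
  ∀ y y', blk lam y = blk lam y' → blk lam (a y) = blk lam (a y') ∧ (a y = a y' → y = y')

theorem rowConst_one (lam : Comp r n) : RowConst (blk lam) 1 (blk lam) :=
  rowConst_iff.2 fun σ hσ => ⟨σ, hσ, by simp⟩

theorem f_mem_idealBelow_of_not_rowInj (hrn : r ≤ n) {lam : Comp r n} {a : Tau r}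
    (ha : RowConst (blk lam) a (blk lam)) (h : ¬ RowInj lam a) :
    RGS.f k lam lam (DC.mk _ _ a) ∈ idealBelow k lam := by
  simp only [RowInj, not_forall] at h
  obtain ⟨y, y', hyy, h⟩ := h
  have hne : y ≠ y' := by
    rintro rfl
    exact h ⟨rfl, fun _ => rfl⟩
  have := f_mul_mem_idealBelow k hrn ha (rowConst_one lam) hyy hne (by tauto)
  rwa [mul_one] at this

theorem exists_card_block_pos {lam : Comp r n} {t : Fin n} (h : 0 < lam.1 t) :
    ∃ x, blk lam x = t := by
  rw [← card_blk, Finset.card_pos] at h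
  obtain ⟨x, hx⟩ := h
  exact ⟨x, (Finset.mem_filter.1 hx).2⟩

/-- A block can be folded onto a block whose size divides its own. -/
theorem exists_fold {lam : Comp r n} {t₀ t₁ : Fin n} {d : ℕ} (hd : 2 ≤ d)
    (h1 : 0 < lam.1 t₁) (h0 : lam.1 t₀ = lam.1 t₁ * d) :
    ∃ a : Tau r, RowConst (blk lam) a (blk lam) ∧ (∀ z, blk lam z ≠ t₀ → a z = z) ∧
      ∃ y y', blk lam y = t₀ ∧ blk lam y' = t₀ ∧ y ≠ y' ∧ a y = a y' := by
  have e : Nonempty ({z // blk lam z = t₀} ≃ {z // blk lam z = t₁} × Fin d) :=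
    ⟨Fintype.equivOfCardEq (by
      rw [Fintype.card_prod, Fintype.card_subtype, Fintype.card_subtype, card_blk, card_blk,
        Fintype.card_fin, h0])⟩
  obtain ⟨e⟩ := e
  -- Block t₀ is identified with d copies of block t₁ and projected onto it; all other points are
  -- fixed.
  let a : Tau r := fun z => if h : blk lam z = t₀ then (e ⟨z, h⟩).1.1 else z
  have ha0 : ∀ z (h : blk lam z = t₀), a z = (e ⟨z, h⟩).1.1 := fun z h => dif_pos h
  have ha1 : ∀ z, blk lam z ≠ t₀ → a z = z := fun z h => dif_neg h
  have hae : ∀ q, a (e.symm q).1 = q.1.1 := by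
    intro q
    rw [ha0 _ (e.symm q).2, Subtype.coe_eta, Equiv.apply_symm_apply]
  refine ⟨a, ?_, ha1, ?_⟩
  · have hc0 : ∀ x, cnt a (blk lam) x t₀ = if blk lam x = t₁ then d else 0 := by
      intro x
      split_ifs with hx
      · rw [cnt, ← Fintype.card_fin d, ← Finset.card_univ]
        symm
        refine Finset.card_bij (fun j _ => (e.symm (⟨x, hx⟩, j)).1) ?_ ?_ ?_
        · intro j _
          simpa using ⟨hae _, (e.symm (⟨x, hx⟩, j)).2⟩
        · intro j _ j' _ h
          simpa using e.symm.injective (Subtype.ext h)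
        · intro z hz
          simp only [Finset.mem_filter, Finset.mem_univ, true_and] at hz
          obtain ⟨rfl, hz⟩ := hz
          refine ⟨(e ⟨z, hz⟩).2, Finset.mem_univ _, ?_⟩
          have : ((⟨a z, hx⟩ : {z // blk lam z = t₁}), (e ⟨z, hz⟩).2) = e ⟨z, hz⟩ :=
            Prod.ext (Subtype.ext (ha0 z hz)) rfl
          rw [this, Equiv.symm_apply_apply]
      · rw [← Nat.le_zero, ← not_lt, cnt_pos]
        rintro ⟨z, rfl, hz⟩
        exact hx (by rw [ha0 z hz]; exact (e ⟨z, hz⟩).1.2)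
    have hc1 : ∀ x t, t ≠ t₀ → cnt a (blk lam) x t = if blk lam x = t then 1 else 0 := by
      intro x t ht
      split_ifs with hx
      · rw [cnt, Finset.card_eq_one]
        refine ⟨x, ?_⟩
        ext z
        simp only [Finset.mem_filter, Finset.mem_univ, true_and, Finset.mem_singleton]
        constructor
        · rintro ⟨rfl, rfl⟩
          rw [ha1 z ht]
        · rintro rfl
          exact ⟨ha1 _ (hx ▸ ht), hx⟩
      · rw [← Nat.le_zero, ← not_lt, cnt_pos]
        rintro ⟨z, rfl, rfl⟩
        rw [ha1 z ht] at hx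
        exact hx rfl
    intro x x' t hx
    by_cases ht : t = t₀
    · rw [ht, hc0, hc0, hx]
    · rw [hc1 _ _ ht, hc1 _ _ ht, hx]
  · obtain ⟨x, hx⟩ := exists_card_block_pos h1
    refine ⟨_, _, (e.symm (⟨x, hx⟩, ⟨0, by omega⟩)).2, (e.symm (⟨x, hx⟩, ⟨1, by omega⟩)).2, ?_, ?_⟩
    · intro h
      simpa using e.symm.injective (Subtype.ext h)
    · rw [hae, hae]

/-- An element whose image misses a block that can be folded onto another one lies in the ideal. -/
theorem f_mem_idealBelow_of_fold (hrn : r ≤ n) {lam : Comp r n} {t₀ t₁ : Fin n} {d : ℕ}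
    (hd : 2 ≤ d) (h1 : 0 < lam.1 t₁) (h0 : lam.1 t₀ = lam.1 t₁ * d) {b : Tau r}
    (hb : RowConst (blk lam) b (blk lam)) (hbt : ∀ z, blk lam (b z) ≠ t₀) :
    RGS.f k lam lam (DC.mk _ _ b) ∈ idealBelow k lam := by
  obtain ⟨a, ha, ha1, y, y', hy, hy', hne, hyy⟩ := exists_fold hd h1 h0
  have := f_mul_mem_idealBelow k hrn ha hb (hy.trans hy'.symm) hne (.inl hyy)
  -- The fold moves only points of block t₀, which the image of b avoids.
  rwa [show a * b = b from funext fun z => ha1 _ (hbt z)] at this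

/-- Injectivity on blocks bounds the count by 1, and row constancy spreads the point over a y to the
whole block of a y. So a maps the block of y bijectively onto that of a y. -/
theorem RowInj.cnt_eq {lam : Comp r n} {a : Tau r} (hi : RowInj lam a)
    (ha : RowConst (blk lam) a (blk lam)) (x y : Fin r) :
    cnt a (blk lam) x (blk lam y) = if blk lam x = blk lam (a y) then 1 else 0 := by
  split_ifs with h
  · refine le_antisymm (Finset.card_le_one.2 fun z hz z' hz' => ?_) ?_
    · simp only [Finset.mem_filter, Finset.mem_univ, true_and] at hz hz'
      exact (hi z z' (hz.2.trans hz'.2.symm)).2 (hz.1.trans hz'.1.symm)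
    · rw [ha _ _ _ h]
      exact cnt_pos.2 ⟨y, rfl, rfl⟩
  · rw [← Nat.le_zero, ← not_lt, cnt_pos]
    rintro ⟨z, rfl, hz⟩
    exact h (hi z y hz).1

theorem RowInj.card_eq {lam : Comp r n} {a : Tau r} (hi : RowInj lam a)
    (ha : RowConst (blk lam) a (blk lam)) (y : Fin r) :
    lam.1 (blk lam (a y)) = lam.1 (blk lam y) := by
  rw [← card_blk, ← card_blk]
  symm
  refine Finset.card_bij (fun z _ => a z) ?_ ?_ ?_
  · intro z hz
    simp only [Finset.mem_filter, Finset.mem_univ, true_and] at hz ⊢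
    exact (hi z y hz).1
  · intro z hz z' hz' h
    simp only [Finset.mem_filter, Finset.mem_univ, true_and] at hz hz'
    exact (hi z z' (hz.trans hz'.symm)).2 h
  · intro x hx
    simp only [Finset.mem_filter, Finset.mem_univ, true_and] at hx ⊢
    have : 0 < cnt a (blk lam) x (blk lam y) := by rw [hi.cnt_eq ha, if_pos hx]; exact one_pos
    obtain ⟨z, h1, h2⟩ := cnt_pos.1 this
    exact ⟨z, h2, h1⟩

/-- By `RowInj.cnt_eq` the counts are determined by the induced map on blocks, so b lies in a G_λ.
-/
theorem RowInj.mk_eq_mk {lam : Comp r n} {a b : Tau r} (hi : RowInj lam a)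
    (ha : RowConst (blk lam) a (blk lam)) (hi' : RowInj lam b)
    (hb : RowConst (blk lam) b (blk lam)) (h : ∀ y, blk lam (a y) = blk lam (b y)) :
    DC.mk (young lam) (young lam) a = DC.mk (young lam) (young lam) b := by
  rw [DC.mk_eq_iff]
  have : ∃ π ∈ colGrp (blk lam), b = a * (π : Tau r) := by
    rw [exists_mul_eq_mul_iff]
    intro x t
    by_cases ht : ∃ y, blk lam y = t
    · obtain ⟨y, rfl⟩ := ht
      rw [hi.cnt_eq ha, hi'.cnt_eq hb, h]
    · have e : ∀ a : Tau r, cnt a (blk lam) x t = 0 := by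
        intro a
        rw [← Nat.le_zero, ← not_lt, cnt_pos]
        rintro ⟨z, -, hz⟩
        exact ht ⟨z, hz⟩
      rw [e, e]
  obtain ⟨π, hπ, e⟩ := this
  exact ⟨1, one_mem _, π, by rwa [young_eq], by simp [e]⟩

end Splitting


/-! ### Rows of a `p`-partition -/

section Rows

variable {r n : ℕ} {p : ℕ}

theorem mem_iff_val_lt_card {S : Finset (Fin n)} (hS : ∀ i j, i ≤ j → j ∈ S → i ∈ S) (j : Fin n) :
    j ∈ S ↔ (j : ℕ) < S.card := by
  constructor
  · intro hj
    have : Finset.Iic j ⊆ S := fun i hi => hS i j (Finset.mem_Iic.1 hi) hj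
    have := Finset.card_le_card this
    rw [Fin.card_Iic] at this
    omega
  · intro hj
    by_contra hc
    have : S ⊆ Finset.Iio j := fun i hi =>
      Finset.mem_Iio.2 (not_le.1 fun hji => hc (hS j i hji hi))
    have := Finset.card_le_card this
    rw [Fin.card_Iio] at this
    omega

/-- Rewrites the offset in terms of the parts themselves, to be compared with the partial sums that
define blocks. -/
theorem offset_eq_sum (hp : p.Prime) {lam : Comp r n} (h : IsPPartition p lam) (i : ℕ) :
    offset p lam i = ∑ x with p ^ i < lam.1 x, lam.1 x := by
  have h1 : ∀ x, ∑ j ∈ Finset.Ioc i r, (if lam.1 x = p ^ j then p ^ j else 0)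
      = if p ^ i < lam.1 x then lam.1 x else 0 := by
    intro x
    rcases h.2 x with h0 | ⟨t, ht⟩
    · rw [h0, if_neg (Nat.not_lt_zero _)]
      exact Finset.sum_eq_zero fun j _ => if_neg (pow_pos hp.pos j).ne
    · have htr : t ≤ r := by
        by_contra hc
        have := mult_eq_zero hp lam (not_le.1 hc)
        rw [mult, Finset.card_eq_zero, Finset.filter_eq_empty_iff] at this
        exact this (Finset.mem_univ x) ht
      have hinj : ∀ j, p ^ t = p ^ j ↔ j = t := fun j =>
        ⟨fun e => (Nat.pow_right_injective hp.two_le e).symm, fun e => by rw [e]⟩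
      rw [ht]
      simp only [hinj, Finset.sum_ite_eq', Finset.mem_Ioc, htr, and_true,
        Nat.pow_lt_pow_iff_right hp.one_lt]
  calc offset p lam i = ∑ j ∈ Finset.Ioc i r, ∑ x, (if lam.1 x = p ^ j then p ^ j else 0) := by
        refine Finset.sum_congr rfl fun j _ => ?_
        rw [← Finset.sum_filter, Finset.sum_const, smul_eq_mul, mult]
    _ = _ := by rw [Finset.sum_comm, Finset.sum_congr rfl fun x _ => h1 x, Finset.sum_filter]

/-- The number of parts greater than `p ^ i`. -/
def numGreater (p : ℕ) (lam : Comp r n) (i : ℕ) : ℕ :=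
  (Finset.univ.filter fun j => p ^ i < lam.1 j).card

/-- Since λ is decreasing, the parts greater than p^i come first and those equal to p^i follow at
once; hence the a-th row of length p^i is the block with index `numGreater` + a. -/
theorem exists_row {lam : Comp r n} (hp : p.Prime) (h : IsPPartition p lam) (i : ℕ)
    (a : Fin (mult p lam i)) : ∃ t : Fin n, (t : ℕ) = numGreater p lam i + a ∧ lam.1 t = p ^ i ∧
      ∀ b, blk lam (pos hp h ⟨i, a, b⟩) = t := by
  let S := Finset.univ.filter fun j => p ^ i < lam.1 j
  let S' := Finset.univ.filter fun j => p ^ i ≤ lam.1 j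
  have hS : ∀ j, j ∈ S ↔ (j : ℕ) < S.card := mem_iff_val_lt_card fun j j' hj hj' => by
    simp only [S, Finset.mem_filter, Finset.mem_univ, true_and] at hj' ⊢
    exact hj'.trans_le (h.1 hj)
  have hS' : ∀ j, j ∈ S' ↔ (j : ℕ) < S'.card := mem_iff_val_lt_card fun j j' hj hj' => by
    simp only [S', Finset.mem_filter, Finset.mem_univ, true_and] at hj' ⊢
    exact hj'.trans (h.1 hj)
  have hcard : S'.card = S.card + mult p lam i := by
    rw [mult, ← Finset.card_union_of_disjoint]
    · congr 1
      ext j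
      simp only [S, S', Finset.mem_filter, Finset.mem_univ, true_and, Finset.mem_union]
      rw [le_iff_lt_or_eq, eq_comm (a := p ^ i)]
    · rw [Finset.disjoint_filter]
      intro j _ h1 h2
      omega
  have hlt : S.card + a < S'.card := by omega
  have hn : S'.card ≤ n := (Finset.card_le_univ _).trans (by simp)
  let t : Fin n := ⟨S.card + a, by omega⟩
  have ht1 : t ∈ S' := (hS' t).2 hlt
  have hval : ∀ j, j ∈ S' → j ∉ S → lam.1 j = p ^ i := by
    intro j h1 h2
    simp only [S, S', Finset.mem_filter, Finset.mem_univ, true_and] at h1 h2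
    omega
  have hts : t ∉ S := fun hc => by
    have := (hS t).1 hc
    simp only [t] at this
    omega
  refine ⟨t, rfl, hval t ht1 hts, fun b => ?_⟩
  have hsub : S ⊆ Finset.Iio t := fun j hj => by
    have := (hS j).1 hj
    rw [Finset.mem_Iio, Fin.lt_def]
    simp only [t]
    omega
  have hsum : ∑ j ∈ Finset.Iio t, lam.1 j = offset p lam i + a * p ^ i := by
    have h1 : ∑ j ∈ Finset.Iio t \ S, lam.1 j = a * p ^ i := by
      have h2 : ∀ j ∈ Finset.Iio t \ S, lam.1 j = p ^ i := by
        intro j hj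
        rw [Finset.mem_sdiff, Finset.mem_Iio, Fin.lt_def] at hj
        exact hval j ((hS' j).2 (hj.1.trans hlt)) hj.2
      rw [Finset.sum_congr rfl h2, Finset.sum_const, Finset.card_sdiff_of_subset hsub,
        Fin.card_Iio, smul_eq_mul]
      simp [t]
    rw [← Finset.sum_sdiff hsub, h1, add_comm, offset_eq_sum hp h]
  rw [← mem_block_iff]
  have hv : ((pos hp h ⟨i, a, b⟩ : Fin r) : ℕ) = offset p lam i + a * p ^ i + b := rfl
  refine ⟨?_, ?_⟩
  · rw [hv, hsum]
    exact Nat.le_add_right _ _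
  · rw [hv, ← Finset.Iio_insert, Finset.sum_insert (by simp), hsum, hval t ht1 hts]
    have := b.2
    omega

/-- The part of `lam` that corresponds to a row. -/
def rowIdx {lam : Comp r n} (hp : p.Prime) (h : IsPPartition p lam)
    (x : Σ i, Fin (mult p lam i)) : Fin n := (exists_row hp h x.1 x.2).choose

section

variable {lam : Comp r n} (hp : p.Prime) (h : IsPPartition p lam)

theorem part_rowIdx (x : Σ i, Fin (mult p lam i)) : lam.1 (rowIdx hp h x) = p ^ x.1 :=
  (exists_row hp h x.1 x.2).choose_spec.2.1

theorem blk_pos (i : ℕ) (a : Fin (mult p lam i)) (b : Fin (p ^ i)) :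
    blk lam (pos hp h ⟨i, a, b⟩) = rowIdx hp h ⟨i, a⟩ :=
  (exists_row hp h i a).choose_spec.2.2 b

theorem rowIdx_injective : Function.Injective (rowIdx hp h) := by
  rintro ⟨i, a⟩ ⟨j, a'⟩ e
  have h1 := part_rowIdx hp h ⟨i, a⟩
  rw [e, part_rowIdx] at h1
  obtain rfl : j = i := Nat.pow_right_injective hp.two_le h1
  have h2 := (exists_row hp h j a).choose_spec.1
  have h3 := (exists_row hp h j a').choose_spec.1
  have h4 : ((exists_row hp h j a).choose : ℕ) = (exists_row hp h j a').choose :=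
    congrArg Fin.val e
  have : a = a' := Fin.ext (by omega)
  rw [this]

theorem exists_pos (x : Fin r) : ∃ i a b, x = pos hp h ⟨i, a, b⟩ :=
  ⟨_, _, _, ((pos hp h).apply_symm_apply x).symm⟩

theorem rowInj_phi (A : ∀ i, Tau (mult p lam i)) : RowInj lam (phi hp h A) := by
  intro y y' hyy
  obtain ⟨i, a, b, rfl⟩ := exists_pos hp h y
  obtain ⟨j, a', b', rfl⟩ := exists_pos hp h y'
  rw [blk_pos, blk_pos] at hyy
  cases rowIdx_injective hp h hyy
  rw [phi_pos, phi_pos, blk_pos, blk_pos]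
  refine ⟨rfl, fun e => ?_⟩
  simpa using (pos hp h).injective e

/-- The permutation that acts by `s i` on the places of every row of length `p ^ i`. -/
def placePerm (s : ∀ i, Equiv.Perm (Fin (p ^ i))) : Equiv.Perm (Fin r) :=
  (pos hp h).permCongr (Equiv.sigmaCongrRight fun i => (Equiv.refl _).prodCongr (s i))

theorem placePerm_pos (s : ∀ i, Equiv.Perm (Fin (p ^ i))) (i : ℕ) (a : Fin (mult p lam i))
    (b : Fin (p ^ i)) : placePerm hp h s (pos hp h ⟨i, a, b⟩) = pos hp h ⟨i, a, s i b⟩ := by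
  simp [placePerm, Equiv.permCongr_apply]

/-- φ_λ(A) moves rows and keeps places, so it commutes with a permutation of places applied
uniformly to all rows of length p^i. Such permutations are transitive on each row. -/
theorem rowConst_phi (A : ∀ i, Tau (mult p lam i)) :
    RowConst (blk lam) (phi hp h A) (blk lam) := by
  intro x x' t hx
  obtain ⟨i, a, b, rfl⟩ := exists_pos hp h x
  obtain ⟨j, a', b', rfl⟩ := exists_pos hp h x'
  rw [blk_pos, blk_pos] at hx
  cases rowIdx_injective hp h hx
  let σ := unitOf (placePerm hp h (Function.update (fun _ => 1) i (Equiv.swap b b')))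
  have hcomm : (σ : Tau r) * phi hp h A = phi hp h A * (σ : Tau r) := by
    funext y
    obtain ⟨j, e, d, rfl⟩ := exists_pos hp h y
    simp [σ, tau_mul_apply, phi_pos, placePerm_pos]
  have hσ : σ ∈ colGrp (blk lam) := by
    intro y
    obtain ⟨j, e, d, rfl⟩ := exists_pos hp h y
    simp [σ, placePerm_pos, blk_pos]
  have := (exists_unit_mul_eq_mul_iff _ _ _).1 ⟨σ, hσ, hcomm⟩ (pos hp h ⟨i, a, b⟩) t
  rw [← this]
  simp [σ, placePerm_pos]

/-- α sends rows to rows of equal length and so induces A; the arrangement inside rows is absorbed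
by the double coset. -/
theorem exists_mk_eq_mk_phi {α : Tau r} (hi : RowInj lam α)
    (hα : RowConst (blk lam) α (blk lam)) :
    ∃ A : ∀ i, Tau (mult p lam i),
      DC.mk (young lam) (young lam) α = DC.mk (young lam) (young lam) (phi hp h A) := by
  have hex : ∀ i (a : Fin (mult p lam i)), ∃ a' : Fin (mult p lam i),
      ∀ b, blk lam (α (pos hp h ⟨i, a, b⟩)) = rowIdx hp h ⟨i, a'⟩ := by
    intro i a
    let b₀ : Fin (p ^ i) := ⟨0, pow_pos hp.pos i⟩
    obtain ⟨j, a', b', e⟩ := exists_pos hp h (α (pos hp h ⟨i, a, b₀⟩))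
    have hc := hi.card_eq hα (pos hp h ⟨i, a, b₀⟩)
    rw [e, blk_pos, blk_pos, part_rowIdx, part_rowIdx] at hc
    obtain rfl : j = i := Nat.pow_right_injective hp.two_le hc
    refine ⟨a', fun b => ?_⟩
    rw [(hi (pos hp h ⟨j, a, b⟩) (pos hp h ⟨j, a, b₀⟩) (by rw [blk_pos, blk_pos])).1, e, blk_pos]
  choose A hA using hex
  refine ⟨A, hi.mk_eq_mk hα (rowInj_phi hp h A) (rowConst_phi hp h A) fun y => ?_⟩
  obtain ⟨i, a, b, rfl⟩ := exists_pos hp h y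
  exact (hA i a b).trans ((congrArg (blk lam) (phi_pos hp h A i a b)).trans
    (blk_pos hp h i _ b)).symm

/-- Young subgroups preserve blocks, so the double coset remembers the map on rows, which is A. -/
theorem phi_mk_injective {A B : ∀ i, Tau (mult p lam i)}
    (e : DC.mk (young lam) (young lam) (phi hp h A) = DC.mk (young lam) (young lam) (phi hp h B)) :
    A = B := by
  obtain ⟨σ, hσ, π, hπ, e⟩ := DC.mk_eq_iff.1 e
  rw [young_eq] at hσ hπ
  funext i a
  let b₀ : Fin (p ^ i) := ⟨0, pow_pos hp.pos i⟩
  have h1 := congrArg (blk lam) (congrFun e (pos hp h ⟨i, a, b₀⟩))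
  rw [tau_mul_apply, tau_mul_apply, hσ,
    (rowInj_phi hp h A _ (pos hp h ⟨i, a, b₀⟩) (hπ _)).1, phi_pos, phi_pos, blk_pos, blk_pos] at h1
  have h2 := rowIdx_injective hp h h1
  simpa using h2.symm

theorem phi_injective : Function.Injective (phi hp h) := fun _ _ e =>
  phi_mk_injective hp h (congrArg _ e)

variable (k : Type*) [CommRing k]

/-- All stabilizers involved are the whole Young subgroup, so the only structure constant is 1. -/
theorem f_phi_mul_f_phi (A B : ∀ i, Tau (mult p lam i)) :
    fAt k lam (phi hp h A) * fAt k lam (phi hp h B) = fAt k lam (phi hp h (A * B)) := by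
  refine Subtype.ext ?_
  rw [map_mul]
  refine f_mul_f_eq_f ?_ ?_
  · intro ρ hρ
    rw [young_eq] at hρ
    obtain ⟨π, hπ, e⟩ := rowConst_iff.1 (rowConst_phi hp h B) ρ hρ
    symm
    rw [DC.mk_eq_iff]
    refine ⟨1, one_mem _, π, by rwa [young_eq], ?_⟩
    rw [mul_assoc, e]
    simp [mul_assoc]
  · rw [((rowConst_phi hp h A).mul (rowConst_phi hp h B)).nRel_young,
      (rowConst_phi hp h A).nRel_young, (rowConst_phi hp h B).nRel_young]

/-- A_i misses some row a₀, whose length p^i is p^(i-m) times that of a row of length p^m. Folding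
the missed row onto the latter leaves φ_λ(A) unchanged. -/
theorem f_phi_mem_idealBelow (hrn : r ≤ n) {m i : ℕ} (hmi : m < i) (hm : mult p lam m ≠ 0)
    {A : ∀ i, Tau (mult p lam i)}
    (hA : ¬ Function.Bijective (A i : Fin (mult p lam i) → Fin (mult p lam i))) :
    RGS.f k lam lam (DC.mk _ _ (phi hp h A)) ∈ idealBelow k lam := by
  have hs : ¬ Function.Surjective (A i : Fin (mult p lam i) → Fin (mult p lam i)) :=
    fun hs => hA (Finite.surjective_iff_bijective.1 hs)
  simp only [Function.Surjective, not_forall, not_exists] at hs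
  obtain ⟨a₀, ha₀⟩ := hs
  refine f_mem_idealBelow_of_fold k hrn (t₀ := rowIdx hp h ⟨i, a₀⟩)
    (t₁ := rowIdx hp h ⟨m, ⟨0, Nat.pos_of_ne_zero hm⟩⟩) (d := p ^ (i - m)) ?_ ?_ ?_
    (rowConst_phi hp h A) ?_
  · exact hp.two_le.trans (Nat.le_self_pow (by omega) p)
  · rw [part_rowIdx]
    exact pow_pos hp.pos m
  · rw [part_rowIdx, part_rowIdx, ← pow_add]
    congr 1
    simp only
    omega
  · intro z hz
    obtain ⟨j, a, b, rfl⟩ := exists_pos hp h z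
    rw [phi_pos, blk_pos] at hz
    have := rowIdx_injective hp h hz
    obtain ⟨rfl, e⟩ := Sigma.mk.inj_iff.1 this
    exact ha₀ a (eq_of_heq e)

end

end Rows


/-! ### The isomorphism `k[S'] ≅ C_R^λ` -/

section Quotient

variable {r n : ℕ} {p : ℕ} (k : Type*) [CommRing k] {lam : Comp r n} (hp : p.Prime)
  (h : IsPPartition p lam)

theorem oneAt_mul_apply (x : BR k r n) (mu l v : Comp r n) (D : DC (young l) (young v)) :
    (oneAt k mu * x) l v D = if l = mu then x l v D else 0 := by
  rw [RGS.mul_apply]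
  split_ifs with h
  · subst h
    rw [Finset.sum_eq_single l, Finset.sum_eq_single (DC.mk _ _ 1)]
    · simp [RGS.idem, RGS.f_self, structConst_one_left]
    · intro E _ hE
      simp [RGS.idem, RGS.f_self, hE]
    · simp
    · intro w _ hw
      simp [RGS.idem, RGS.f_of_ne_right hw]
    · simp
  · refine Finset.sum_eq_zero fun w _ => Finset.sum_eq_zero fun E₁ _ =>
      Finset.sum_eq_zero fun E₂ _ => ?_
    simp [RGS.idem, RGS.f_of_ne_left h]

theorem eq_sum_f (x : BRAt k lam) :
    x.1 = ∑ D : DC (young lam) (young lam), x.1 lam lam D • RGS.f k lam lam D := by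
  have hx := (Subsemigroup.mem_corner_iff (isIdempotentElem_oneAt k lam)).1 x.2
  apply RGS.ext
  intro l v D
  rw [RGS.sum_apply]
  simp only [RGS.smul_apply]
  by_cases hl : l = lam
  · subst hl
    by_cases hv : v = l
    · subst hv
      simp [RGS.f_self]
    · conv_lhs => rw [← hx.2, mul_oneAt_apply, if_neg hv]
      simp [RGS.f_of_ne_right hv]
  · conv_lhs => rw [← hx.1, oneAt_mul_apply, if_neg hl]
    simp [RGS.f_of_ne_left hl]

/-- The projection `Π_R` as a homomorphism of algebras. -/
def PiRAlg (lam : Comp r n) : BRAt k lam →ₐ[k] CR k lam := RingCon.mkₐ (α := k) _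

theorem PiRAlg_apply (x : BRAt k lam) : PiRAlg k lam x = PiR k lam x := rfl

theorem PiRAlg_eq_zero {x : BRAt k lam} : PiRAlg k lam x = 0 ↔ x.1 ∈ idealBelow k lam := by
  rw [← mem_idealAt, TwoSidedIdeal.mem_iff, ← map_zero (PiRAlg k lam)]
  exact RingCon.eq _

/-- The elements `f(λ, α, λ)`, `α ∈ S_r^λ`, multiply like the transformations `α`. -/
def fHom : SLam hp h →* BRAt k lam where
  toFun α := fAt k lam α
  map_one' := rfl
  map_mul' := by
    rintro ⟨_, A, rfl⟩ ⟨_, B, rfl⟩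
    rw [f_phi_mul_f_phi, map_mul]
    rfl

theorem psiR_single (α : SLam hp h) (c : k) :
    psiR k hp h (MonoidAlgebra.single α c) = c • fAt k lam α := by
  simp [psiR]

theorem psiR_eq_lift (x : MonoidAlgebra k (SLam hp h)) :
    psiR k hp h x = MonoidAlgebra.lift k _ _ (fHom k hp h) x := by
  induction x using MonoidAlgebra.induction_linear with
  | zero => simp
  | add x y hx hy => rw [map_add, map_add, hx, hy]
  | single a b => rw [psiR_single, MonoidAlgebra.lift_single]; rfl

/-- The map `k[S'] → C_R^λ` as a homomorphism of algebras. -/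
def primeHom (m : ℕ) : MonoidAlgebra k (SPrime hp h m) →ₐ[k] CR k lam :=
  ((PiRAlg k lam).comp (MonoidAlgebra.lift k _ _ (fHom k hp h))).comp (inclPrime k hp h m)

theorem primeHom_apply (m : ℕ) (x : MonoidAlgebra k (SPrime hp h m)) :
    primeHom k hp h m x = PiR k lam (psiR k hp h (inclPrime k hp h m x)) := by
  rw [psiR_eq_lift]
  rfl

theorem primeHom_single (m : ℕ) (α : SPrime hp h m) (c : k) :
    primeHom k hp h m (MonoidAlgebra.single α c) = c • PiRAlg k lam (fAt k lam α) := by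
  rw [primeHom_apply, ← PiRAlg_apply]
  simp [inclPrime, psiR_single]

/-- Distinct elements of S' lie in distinct double cosets, so coefficients in k[S'] can be read off
as coordinates. -/
theorem psiR_inclPrime_apply (m : ℕ) (x : MonoidAlgebra k (SPrime hp h m)) (α : SPrime hp h m) :
    (psiR k hp h (inclPrime k hp h m x)).1 lam lam (DC.mk _ _ (α : Tau r)) = x.coeff α := by
  induction x using MonoidAlgebra.induction_linear with
  | zero => simp; rfl
  | add x y hx hy =>
    rw [map_add, map_add, MonoidAlgebra.coeff_add, Finsupp.add_apply, ← hx, ← hy]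
    rfl
  | single β c =>
    have : psiR k hp h (inclPrime k hp h m (MonoidAlgebra.single β c)) = c • fAt k lam β := by
      simp [inclPrime, psiR_single]
    rw [this, MonoidAlgebra.coeff_single, Finsupp.single_apply]
    change c * RGS.f k lam lam (DC.mk _ _ (β : Tau r)) lam lam (DC.mk _ _ (α : Tau r)) = _
    rw [RGS.f_self]
    have hiff : DC.mk (young lam) (young lam) (α : Tau r) = DC.mk _ _ (β : Tau r) ↔ β = α := by
      constructor
      · intro e
        obtain ⟨_, A, hA, rfl⟩ := α
        obtain ⟨_, B, hB, rfl⟩ := β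
        exact Subtype.ext (congrArg (phi hp h) (phi_mk_injective hp h e).symm)
      · rintro rfl
        rfl
    simp only [hiff, mul_ite, mul_one, mul_zero]

/-- A basis element outside the ideal must be row-constant and injective on blocks, hence equal to
one of φ_λ(A), and A_i must be bijective for i > m. The characteristic plays no role here. -/
theorem primeHom_surjective (hrn : r ≤ n) {m : ℕ} (hm : mult p lam m ≠ 0) :
    Function.Surjective (primeHom k hp h m) := by
  rw [← AlgHom.range_eq_top, eq_top_iff]
  rintro y -
  obtain ⟨x, rfl⟩ : ∃ x, PiRAlg k lam x = y := RingCon.mkₐ_surjective _ y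
  have hx : x = ∑ D : DC (young lam) (young lam), x.1 lam lam D • fAt k lam D.out := by
    refine Subtype.ext ?_
    let ι : BRAt k lam →+ BR k r n := (cornerIncl (isIdempotentElem_oneAt k lam)).toAddMonoidHom
    change ι x = ι _
    rw [map_sum]
    refine (eq_sum_f k x).trans (Finset.sum_congr rfl fun D _ => ?_)
    change _ = x.1 lam lam D • RGS.f k lam lam (DC.mk _ _ D.out)
    rw [show DC.mk _ _ D.out = D from Quotient.out_eq D]
  rw [hx, map_sum]
  refine Subalgebra.sum_mem _ fun D _ => ?_
  rw [map_smul]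
  refine Subalgebra.smul_mem _ ?_ _
  by_cases hD : RGS.f k lam lam (DC.mk _ _ D.out) ∈ idealBelow k lam
  · rw [show PiRAlg k lam (fAt k lam D.out) = 0 from (PiRAlg_eq_zero k).2 hD]
    exact Subalgebra.zero_mem _
  · have h1 : RowConst (blk lam) D.out (blk lam) := by
      by_contra hc
      exact hD (f_mem_idealBelow_of_not_rowConst k hrn hc)
    have h2 : RowInj lam D.out := by
      by_contra hc
      exact hD (f_mem_idealBelow_of_not_rowInj k hrn h1 hc)
    obtain ⟨A, hA⟩ := exists_mk_eq_mk_phi hp h h2 h1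
    have hA' : ∀ i, m < i →
        Function.Bijective (A i : Fin (mult p lam i) → Fin (mult p lam i)) := by
      intro i hi
      by_contra hc
      rw [hA] at hD
      exact hD (f_phi_mem_idealBelow hp h k hrn hi hm hc)
    refine ⟨MonoidAlgebra.single ⟨phi hp h A, A, hA', rfl⟩ 1, ?_⟩
    change primeHom k hp h m _ = _
    rw [primeHom_single, one_smul]
    congr 1
    refine Subtype.ext ?_
    change RGS.f k lam lam (DC.mk _ _ (phi hp h A)) = RGS.f k lam lam (DC.mk _ _ D.out)
    rw [hA]

/-- Elements of the ideal have zero coordinate at each f(λ,α,λ) with α ∈ S', since the structure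
constants there vanish modulo p. Minimality of m makes q = p^m divide every part; bijectivity of A_i
for i > m puts all longer rows in the image. -/
theorem primeHom_injective [CharP k p] {m : ℕ} (hm : IsLeast {i | mult p lam i ≠ 0} m) :
    Function.Injective (primeHom k hp h m) := by
  rw [injective_iff_map_eq_zero]
  intro x hx
  rw [primeHom_apply, ← PiRAlg_apply, PiRAlg_eq_zero] at hx
  ext α
  rw [← psiR_inclPrime_apply]
  obtain ⟨_, A, hA, rfl⟩ := α
  have hpart : ∀ j, lam.1 j = 0 ∨ ∃ i, m ≤ i ∧ lam.1 j = p ^ i := by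
    intro j
    rcases h.2 j with h0 | ⟨i, hi⟩
    · exact .inl h0
    · refine .inr ⟨i, hm.2 ?_, hi⟩
      exact (Finset.card_pos.2 ⟨j, by simp [hi]⟩).ne'
  refine idealBelow_apply_eq_zero k (fun mu hmu D₁ D₂ => ?_) hx
  rw [CharP.cast_eq_zero_iff k p]
  refine prime_dvd_structConst hp h (pow_pos hp.pos m) ?_ (rowConst_phi hp h A) ?_ hmu D₁ D₂
  · intro j
    rcases hpart j with h0 | ⟨i, hi, e⟩
    · rw [h0]
      exact dvd_zero _
    · rw [e]
      exact pow_dvd_pow p hi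
  · intro x hx
    obtain ⟨i, a, b, rfl⟩ := exists_pos hp h x
    rw [blk_pos, part_rowIdx] at hx
    obtain ⟨a', ha'⟩ := (hA i ((Nat.pow_lt_pow_iff_right hp.one_lt).1 hx)).2 a
    exact ⟨pos hp h ⟨i, a', b⟩, (phi_pos hp h A i a' b).trans (by rw [ha'])⟩

end Quotient

/-! ### The monoid `S'` and the algebra `k[S']` -/

section Monoid

variable {r n : ℕ} {p : ℕ} {lam : Comp r n} (hp : p.Prime) (h : IsPPartition p lam)

/-- The submonoid `τ_{s_m} · ∏_{i > m} 𝔖_{s_i}` of `∏ τ_{s_i}`. -/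
def bijAbove (p : ℕ) (lam : Comp r n) (m : ℕ) : Submonoid (∀ i, Tau (mult p lam i)) where
  carrier := {α | ∀ i, m < i →
    Function.Bijective (α i : Fin (mult p lam i) → Fin (mult p lam i))}
  one_mem' := fun _ _ => Function.bijective_id
  mul_mem' := fun hα hβ i hi => (hα i hi).comp (hβ i hi)

/-- The components of an element of `τ_{s_m} · ∏_{i > m} 𝔖_{s_i}`. -/
def bijAboveHom (p : ℕ) (lam : Comp r n) (m M : ℕ) :
    bijAbove p lam m →*
      Tau (mult p lam m) × ∀ i : Finset.Ioc m M, Equiv.Perm (Fin (mult p lam i)) where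
  toFun α := (α.1 m, fun i => Equiv.ofBijective _ (α.2 i (Finset.mem_Ioc.1 i.2).1))
  map_one' := Prod.ext rfl (funext fun _ => Equiv.ext fun _ => rfl)
  map_mul' _ _ := Prod.ext rfl (funext fun _ => Equiv.ext fun _ => rfl)

/-- Indices other than m and those in (m, M] have s_i = 0, so their components carry no information.
-/
theorem bijAboveHom_bijective {m M : ℕ} (hm : IsLeast {i | mult p lam i ≠ 0} m)
    (hM : IsGreatest {i | mult p lam i ≠ 0} M) : Function.Bijective (bijAboveHom p lam m M) := by
  have hsub : ∀ i, i ≠ m → i ∉ Finset.Ioc m M → IsEmpty (Fin (mult p lam i)) := by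
    intro i h1 h2
    have : mult p lam i = 0 := by
      by_contra hc
      have h3 := hm.2 hc
      have h4 := hM.2 hc
      rw [Finset.mem_Ioc] at h2
      omega
    rw [this]
    infer_instance
  constructor
  · intro α β e
    refine Subtype.ext (funext fun i => ?_)
    by_cases h1 : i = m
    · subst h1
      exact congrArg Prod.fst e
    · by_cases h2 : i ∈ Finset.Ioc m M
      · have := congrFun (congrArg Prod.snd e) ⟨i, h2⟩
        exact congrArg (fun σ : Equiv.Perm _ => (σ : Fin (mult p lam i) → Fin (mult p lam i))) this
      · have := hsub i h1 h2
        funext x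
        exact isEmptyElim x
  · rintro ⟨t, σ⟩
    let A : ∀ i, Tau (mult p lam i) := fun i =>
      if h1 : i = m then h1 ▸ t else if h2 : i ∈ Finset.Ioc m M then
        (σ ⟨i, h2⟩ : Fin (mult p lam i) → Fin (mult p lam i)) else 1
    have hAm : A m = t := by simp [A]
    have hAi : ∀ i (h2 : i ∈ Finset.Ioc m M), A i = (σ ⟨i, h2⟩ : Fin (mult p lam i) → _) := by
      intro i h2
      have : i ≠ m := by
        rw [Finset.mem_Ioc] at h2
        omega
      exact (dif_neg this).trans (dif_pos h2)
    have hA : A ∈ bijAbove p lam m := by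
      intro i hi
      by_cases h2 : i ∈ Finset.Ioc m M
      · rw [hAi i h2]
        exact (σ ⟨i, h2⟩).bijective
      · have := hsub i hi.ne' h2
        exact ⟨fun x => isEmptyElim x, fun x => isEmptyElim x⟩
    refine ⟨⟨A, hA⟩, Prod.ext hAm (funext fun i => Equiv.ext fun x => ?_)⟩
    exact congrFun (hAi i.1 i.2) x

/-- `S' ≅ τ_{s_m} × ∏_{i > m} 𝔖_{s_i}`. -/
def primeEquiv {m M : ℕ} (hm : IsLeast {i | mult p lam i ≠ 0} m)
    (hM : IsGreatest {i | mult p lam i ≠ 0} M) : SPrime hp h m ≃*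
      Tau (mult p lam m) × ∀ i : Finset.Ioc m M, Equiv.Perm (Fin (mult p lam i)) :=
  ((bijAbove p lam m).equivMapOfInjective (phi hp h) (phi_injective hp h)).symm.trans
    (MulEquiv.ofBijective _ (bijAboveHom_bijective hm hM))

end Monoid

/-! ### Monoid algebras of products as tensor products. -/

section Tensor

/-- The homomorphism agrees on a basis with the linear equivalence matching the two bases. -/
theorem bijective_of_basis {k M A : Type*} [CommSemiring k] [Monoid M] [Semiring A] [Algebra k A]
    (φ : MonoidAlgebra k M →ₐ[k] A) (b : Module.Basis M k A)
    (hφ : ∀ m, φ (MonoidAlgebra.single m 1) = b m) : Function.Bijective φ := by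
  have : φ.toLinearMap = ((MonoidAlgebra.basis M k).equiv b (Equiv.refl M)).toLinearMap := by
    refine (MonoidAlgebra.basis M k).ext fun m => ?_
    refine (hφ m).trans ?_
    have := (MonoidAlgebra.basis M k).equiv_apply m b (Equiv.refl M)
    exact this.symm
  have h2 : (φ : MonoidAlgebra k M → A) = (MonoidAlgebra.basis M k).equiv b (Equiv.refl M) :=
    congrArg DFunLike.coe this
  rw [h2]
  exact LinearEquiv.bijective _

/-- The map `(a, b) ↦ a ⊗ b` as a homomorphism of monoids. -/
def tmulHom (k A B : Type*) [CommSemiring k] [Semiring A] [Algebra k A] [Semiring B]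
    [Algebra k B] : A × B →* TensorProduct k A B where
  toFun x := x.1 ⊗ₜ[k] x.2
  map_one' := rfl
  map_mul' x y := (Algebra.TensorProduct.tmul_mul_tmul x.1 y.1 x.2 y.2).symm

variable (k : Type*) [CommRing k] (S : Type*) [Monoid S] {ι : Type*} [Fintype ι] (G : ι → Type*)
  [∀ i, Monoid (G i)]

/-- The canonical map from `∏ G_i` to `⨂ k[G_i]`. -/
def tprodOfHom : (∀ i, G i) →* PiTensorProduct k fun i => MonoidAlgebra k (G i) :=
  (PiTensorProduct.tprodMonoidHom k).comp
    (MonoidHom.pi fun i => (MonoidAlgebra.of k (G i)).comp (Pi.evalMonoidHom G i))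

/-- The canonical map from `S × ∏ G_i` to `k[S] ⊗ ⨂ k[G_i]`. -/
def tensorMonoidHom : S × (∀ i, G i) →*
    TensorProduct k (MonoidAlgebra k S) (PiTensorProduct k fun i => MonoidAlgebra k (G i)) :=
  (tmulHom k _ _).comp ((MonoidAlgebra.of k S).prodMap (tprodOfHom k G))

/-- `k[S × ∏ G_i] ≅ k[S] ⊗ ⨂ k[G_i]`. -/
def tensorEquiv : MonoidAlgebra k (S × ∀ i, G i) ≃ₐ[k]
    TensorProduct k (MonoidAlgebra k S) (PiTensorProduct k fun i => MonoidAlgebra k (G i)) :=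
  AlgEquiv.ofBijective (MonoidAlgebra.lift k _ _ (tensorMonoidHom k S G))
    (bijective_of_basis _ ((MonoidAlgebra.basis S k).tensorProduct
      (Basis.piTensorProduct fun i => MonoidAlgebra.basis (G i) k)) fun m => by
        rw [MonoidAlgebra.lift_single, one_smul, Module.Basis.tensorProduct_apply',
          Basis.piTensorProduct_apply]
        rfl)

end Tensor

end GSchur

end

theorem proposition8p3 {k : Type*} [Field k] {p : ℕ} (hp : p.Prime) [CharP k p] {r n : ℕ}
    (hrn : r ≤ n) (lam : GSchur.Comp r n) (hlam : GSchur.IsPPartition p lam) {m M : ℕ}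
    (hm : IsLeast {i | GSchur.mult p lam i ≠ 0} m)
    (hM : IsGreatest {i | GSchur.mult p lam i ≠ 0} M) :
    (∃ Φ : MonoidAlgebra k (GSchur.SPrime hp hlam m) ≃ₐ[k] GSchur.CR k lam,
      ∀ x, Φ x = GSchur.PiR k lam (GSchur.psiR k hp hlam (GSchur.inclPrime k hp hlam m x))) ∧
    Nonempty (MonoidAlgebra k (GSchur.SPrime hp hlam m) ≃ₐ[k]
      MonoidAlgebra k (GSchur.Tau (GSchur.mult p lam m) ×
        ∀ i : Finset.Ioc m M, Equiv.Perm (Fin (GSchur.mult p lam i)))) ∧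
    Nonempty (GSchur.CR k lam ≃ₐ[k]
      TensorProduct k (MonoidAlgebra k (GSchur.Tau (GSchur.mult p lam m)))
        (PiTensorProduct k fun i : Finset.Ioc m M =>
          MonoidAlgebra k (Equiv.Perm (Fin (GSchur.mult p lam i))))) := by
  have hbij : Function.Bijective (GSchur.primeHom k hp hlam m) :=
    ⟨GSchur.primeHom_injective k hp hlam hm, GSchur.primeHom_surjective k hp hlam hrn hm.1⟩
  let Φ := AlgEquiv.ofBijective (GSchur.primeHom k hp hlam m) hbij
  let Ψ := MonoidAlgebra.domCongr k k (GSchur.primeEquiv hp hlam hm hM)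
  refine ⟨⟨Φ, GSchur.primeHom_apply k hp hlam m⟩, ⟨Ψ⟩, ⟨(Φ.symm.trans Ψ).trans ?_⟩⟩
  exact GSchur.tensorEquiv k _ _
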